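/- Let $p\ge 1$ and let $\{Y_t\}_{t\in\mathbb Z}$ be a strictly stationary, mean-zero Gaussian sequence of random vectors in $\mathbb R^p$ (all finite families $(Y_{t_1},\dots,Y_{t_k})$ are jointly Gaussian). Put $\Sigma_m:=\mathbb E\,Y_1Y_{1+m}^{\sf T}$ and $\hat\Sigma_m:=(n-m)^{-1}\sum_{i=1}^{n-m}Y_iY_{i+m}^{\sf T}$, let $\|\cdot\|$ be the spectral norm of matrices, assume $\Sigma_0\neq 0$, and let $r(\Sigma_0):=\operatorname{Tr}(\Sigma_0)/\|\Sigma_0\|$. For a random variable $X$ write $\|X\|_{L(q)}:=(\mathbb E|X|^q)^{1/q}$ and $\|X\|_{\psi_2}:=\inf\{k>0:\mathbb E[\exp\{(|X|/k)^2\}-1]\le 1\}$, and let $\kappa_1:=\sup_{t\in\mathbb Z}\sup_{\|u\|_2=1}\|u^{\sf T}Y_t\|_{\psi_2}$. Let $\epsilon>1$ and $\gamma_1,\gamma_2,\gamma_3,\gamma_4>0$ be such that the following two conditions hold. (A2) For every integer $j$ there is a sequence $\{\tilde Y_t\}_{t>j}$ of random vectors (possibly on an extension of the probability space), independent of $\sigma(\{Y_t\}_{t\le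 j})$ and distributed as $\{Y_t\}_{t>j}$, such that for every integer $k\ge j+1$, $$\big\|\,\|Y_k-\tilde Y_k\|_2\,\big\|_{L(1+\epsilon)}\le\gamma_1\kappa_1\exp\{-\gamma_2(k-j-1)\}.$$ (A3) For every integer $j$ there is a sequence $\{\tilde Y_t\}_{t>j}$ of random vectors (possibly on an extension of the probability space, and possibly different from the one in (A2)), independent of $\sigma(\{Y_t\}_{t\le j})$ and distributed as $\{Y_t\}_{t>j}$, such that for every integer $k\ge j+1$, $$\sup_{\|u\|_2=1}\big\|(Y_k-\tilde Y_k)^{\sf T}u\big\|_{L(1+\epsilon)}\le\gamma_3\kappa_1\exp\{-\gamma_4(k-j-1)\}.$$ Suppose moreover that $\gamma_1\le K_1\sqrt{r(\Sigma_0)}$ and $\gamma_3\le K_3$ for constants $K_1,K_3>0$. Then, for all integers $n\ge 2$ and $0\le m\le n-1$, the random variable $\|\hat\Sigma_m-\Sigma_m\|$ is integrable and $$\mathbb E\|\hat\Sigma_m-\Sigma_m\|\le C\,\|\Sigma_0\|\left(\sqrt{\frac{r(\Sigma_0)}{n-m}}+\frac{r(\Sigma_0)}{n-m}\right),$$ where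 the constant $C>0$ depends only on $\epsilon,m,\gamma_2,\gamma_4$ and the constants $K_1,K_3$; in particular it does not depend on $n$, on the dimension $p$, or on the law of the sequence. -/

import Mathlib

open MeasureTheory ProbabilityTheory
open scoped ENNReal

-- The norm on matrices is the spectral norm (operator norm for Euclidean norms).
open scoped Matrix.Norms.L2Operator

universe u

noncomputable section

/-- The `ψ₂` norm `inf {k ∈ (0, ∞) : E[exp((|X| / k)²) - 1] ≤ 1}` of a real random variable,
as an extended nonnegative real number (it is `∞` if there is no such `k`). -/
def psi2Norm {Ω : Type u} [MeasurableSpace Ω] (P : Measure Ω) (X : Ω → ℝ) : ℝ≥0∞ :=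
  ⨅ k ∈ {k : ℝ | 0 < k ∧ ∫⁻ ω, ENNReal.ofReal (Real.exp ((|X ω| / k) ^ 2) - 1) ∂P ≤ 1},
    ENNReal.ofReal k

/-- `κ₁ = sup_t sup_{‖u‖₂ = 1} ‖uᵀ Y_t‖_{ψ₂}`. -/
def kappaOne {Ω : Type u} [MeasurableSpace Ω] {p : ℕ} (P : Measure Ω)
    (Y : ℤ → Ω → EuclideanSpace ℝ (Fin p)) : ℝ≥0∞ :=
  ⨆ t : ℤ, ⨆ v ∈ Metric.sphere (0 : EuclideanSpace ℝ (Fin p)) 1,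
    psi2Norm P (fun ω => inner ℝ v (Y t ω))

/-- Strict stationarity: every time shift of the process has the law of the process. -/
def IsStationaryProcess {Ω : Type u} [MeasurableSpace Ω] {p : ℕ} (P : Measure Ω)
    (Y : ℤ → Ω → EuclideanSpace ℝ (Fin p)) : Prop :=
  ∀ h : ℤ, IdentDistrib (fun ω (t : ℤ) => Y (t + h) ω) (fun ω (t : ℤ) => Y t ω) P P

/-- The sequence `Z = (Z_t)_{t > j}` is independent of `σ(Y_t, t ≤ j)` and distributed as
`(Y_t)_{t > j}`. It may live on an extension `(Ω', P')` of the original probability space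
`(Ω, P)`, with projection `π`; for `Ω' = Ω` and `π = id` there is no extension. -/
structure IsDecoupledFuture {Ω Ω' : Type u} [MeasurableSpace Ω] [MeasurableSpace Ω'] {p : ℕ}
    (P : Measure Ω) (Y : ℤ → Ω → EuclideanSpace ℝ (Fin p)) (j : ℤ)
    (P' : Measure Ω') (π : Ω' → Ω) (Z : Set.Ioi j → Ω' → EuclideanSpace ℝ (Fin p)) : Prop where
  extension : MeasurePreserving π P' P
  indep : IndepFun (fun ω (t : Set.Ioi j) => Z t ω) (fun ω (t : Set.Iic j) => Y t (π ω)) P'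
  identDistrib : IdentDistrib (fun ω (t : Set.Ioi j) => Z t ω)
    (fun ω (t : Set.Ioi j) => Y t ω) P' P

/-- Coupling condition in Euclidean norm: for every `j` there is a decoupled future `Z` with
`‖ ‖Y_k - Z_k‖₂ ‖_{L(1+ε)} ≤ γ₁ κ₁ exp(-γ₂ (k - j - 1))` for all `k ≥ j + 1`. -/
def NormCoupling {Ω : Type u} [MeasurableSpace Ω] {p : ℕ} (P : Measure Ω)
    (Y : ℤ → Ω → EuclideanSpace ℝ (Fin p)) (γ₁ γ₂ ε : ℝ) : Prop :=
  ∀ j : ℤ, ∃ (Ω' : Type u) (_ : MeasurableSpace Ω') (P' : Measure Ω') (π : Ω' → Ω)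
    (Z : Set.Ioi j → Ω' → EuclideanSpace ℝ (Fin p)), IsDecoupledFuture P Y j P' π Z ∧
    ∀ k : Set.Ioi j,
      eLpNorm (fun ω => ‖Y k (π ω) - Z k ω‖) (ENNReal.ofReal (1 + ε)) P' ≤
        ENNReal.ofReal γ₁ * kappaOne P Y *
          ENNReal.ofReal (Real.exp (-γ₂ * (((k : ℤ) : ℝ) - (j : ℝ) - 1)))

/-- Directional coupling condition: for every `j` there is a decoupled future `Z` with
`sup_{‖u‖₂ = 1} ‖(Y_k - Z_k)ᵀ u‖_{L(1+ε)} ≤ γ₃ κ₁ exp(-γ₄ (k - j - 1))` for all `k ≥ j + 1`. -/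
def DirectionalCoupling {Ω : Type u} [MeasurableSpace Ω] {p : ℕ} (P : Measure Ω)
    (Y : ℤ → Ω → EuclideanSpace ℝ (Fin p)) (γ₃ γ₄ ε : ℝ) : Prop :=
  ∀ j : ℤ, ∃ (Ω' : Type u) (_ : MeasurableSpace Ω') (P' : Measure Ω') (π : Ω' → Ω)
    (Z : Set.Ioi j → Ω' → EuclideanSpace ℝ (Fin p)), IsDecoupledFuture P Y j P' π Z ∧
    ∀ k : Set.Ioi j,
      (⨆ v ∈ Metric.sphere (0 : EuclideanSpace ℝ (Fin p)) 1,
        eLpNorm (fun ω => inner ℝ (Y k (π ω) - Z k ω) v) (ENNReal.ofReal (1 + ε)) P') ≤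
          ENNReal.ofReal γ₃ * kappaOne P Y *
            ENNReal.ofReal (Real.exp (-γ₄ * (((k : ℤ) : ℝ) - (j : ℝ) - 1)))

/-- The lag-`m` autocovariance matrix `Σ_m = E Y_1 Y_{1+m}ᵀ` of a stationary mean-zero process. -/
def autocov {Ω : Type u} [MeasurableSpace Ω] {p : ℕ} (P : Measure Ω)
    (Y : ℤ → Ω → EuclideanSpace ℝ (Fin p)) (m : ℕ) : Matrix (Fin p) (Fin p) ℝ :=
  Matrix.of fun a b => ∫ ω, Y 1 ω a * Y (1 + (m : ℤ)) ω b ∂P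

/-- The sample autocovariance matrix `(n - m)⁻¹ ∑_{i=1}^{n-m} Y_i Y_{i+m}ᵀ`. -/
def sampleAutocov {Ω : Type u} {p : ℕ} (Y : ℤ → Ω → EuclideanSpace ℝ (Fin p)) (n m : ℕ) (ω : Ω) :
    Matrix (Fin p) (Fin p) ℝ :=
  ((n : ℝ) - (m : ℝ))⁻¹ • ∑ i ∈ Finset.Icc 1 (n - m),
    Matrix.of fun a b => Y (i : ℤ) ω a * Y ((i : ℤ) + (m : ℤ)) ω b

/-- The effective rank `r(A) = Tr A / ‖A‖`. -/
def effRank {p : ℕ} (A : Matrix (Fin p) (Fin p) ℝ) : ℝ := A.trace / ‖A‖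

end

/-! ### Exponential change of measure for standard Gaussians. -/

section CameronMartin

/-! The spectral norm is controlled by a variational (PAC-Bayes) argument with Gaussian smoothing,
so that dimension enters only through the effective rank `r`. Write `ρ = ‖Σ₀‖` and `N = n - m`.

Decoupling. By rotation invariance of a centred Gaussian pair, `E‖∑ UᵢVᵢᵀ - E∑ UᵢVᵢᵀ‖` is at most
twice `E‖∑ Uᵢ V'ᵢᵀ‖`, where `V'` comes from an independent copy (`integral_norm_outerSum_sub_le`).

Variational bound. Given `U = x`, the variable `∑ ⟨a, xᵢ⟩⟨b, V'ᵢ⟩` is centred Gaussian with variance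
at most `(∑ ⟨a, xᵢ⟩²) q(b)`. Subtracting half the variance bound in the exponent therefore gives an
exponential moment at most 1 for each fixed `(a, b)`, and also after averaging `(a, b)` over a
Gaussian prior of covariance `σ² I`. Recentring the prior at any `(a, b)` in the product of unit
balls costs relative entropy at most `1 / σ²`, so one random variable of mean at most 1 controls all
directions at once (`le_gibbsIntegral`, `integral_norm_outerSum_prod_le`). With `σ² = 1 / r` the
entropy cost is `r`, and the smoothing adds only `σ² ∑ E‖Uᵢ‖² = N ρ`, the size of `‖E∑ UᵢUᵢᵀ‖`.

Self-bounding. The bound contains `E‖∑ UᵢUᵢᵀ‖`, which by decoupling is at most `N ρ` plus twice the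
quantity being bounded in the case `V = U`. A small parameter absorbs it, leaving order `ρ (√(r N) +
r)` (`le_of_self_bounding`).

Dependence. The proxy `q` is the sum over lags of `|vᵀ Σₖ v|`. Only its smoothed value at `b + σ z`
is needed. Replacing `Y_{1+k}` by its difference with a decoupled future leaves `Σₖ` unchanged. The
directional coupling handles the fixed part `b`, and the norm coupling handles `σ z`, where `σ² = 1
/ r` compensates `γ₁² ≤ K₁² r`. Both decay geometrically in `k`, so smoothed `q` is at most a
constant times `ρ` (`integral_varianceProxy_le`). -/

lemma gaussianReal_withDensity_exp (h : ℝ) :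
    (gaussianReal 0 1).withDensity (fun x => ENNReal.ofReal (Real.exp (h * x - h ^ 2 / 2))) =
      gaussianReal h 1 := by
  rw [gaussianReal_of_var_ne_zero _ one_ne_zero, gaussianReal_of_var_ne_zero _ one_ne_zero,
    ← withDensity_mul _ (by fun_prop) (by fun_prop)]
  congr 1
  ext x
  simp only [Pi.mul_apply, gaussianPDF, gaussianPDFReal]
  rw [← ENNReal.ofReal_mul (by positivity), mul_assoc, ← Real.exp_add]
  congr 3
  simp
  ring

lemma pi_gaussianReal_withDensity_exp {ι : Type*} [Fintype ι] (h : ι → ℝ) :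
    (Measure.pi fun _ : ι => gaussianReal 0 1).withDensity
        (fun x => ENNReal.ofReal (Real.exp (∑ i, (h i * x i - h i ^ 2 / 2)))) =
      Measure.pi fun i => gaussianReal (h i) 1 := by
  symm
  refine Measure.pi_eq fun s hs => ?_
  set f : ι → ℝ → ℝ≥0∞ := fun i x => ENNReal.ofReal (Real.exp (h i * x - h i ^ 2 / 2))
  have hf : ∀ i, Measurable (f i) := fun i => by fun_prop
  rw [withDensity_apply _ (MeasurableSet.univ_pi hs),
    ← lintegral_indicator (MeasurableSet.univ_pi hs)]
  have key : (Set.univ.pi s).indicator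
      (fun x => ENNReal.ofReal (Real.exp (∑ i, (h i * x i - h i ^ 2 / 2)))) =
      fun x => ∏ i, (s i).indicator (f i) (x i) := by
    ext x
    by_cases hx : x ∈ Set.univ.pi s
    · rw [Set.indicator_of_mem hx, Real.exp_sum,
        ENNReal.ofReal_prod_of_nonneg fun i _ => (Real.exp_pos _).le]
      exact Finset.prod_congr rfl fun i _ => by
        rw [Set.indicator_of_mem (hx i (Set.mem_univ i))]
    · rw [Set.indicator_of_notMem hx]
      simp only [Set.mem_pi, Set.mem_univ, true_imp_iff, not_forall] at hx
      obtain ⟨i, hi⟩ := hx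
      exact (Finset.prod_eq_zero (Finset.mem_univ i) (Set.indicator_of_notMem hi _)).symm
  rw [key, lintegral_prod_eq_prod_lintegral_of_indepFun Finset.univ
    (fun i (x : ι → ℝ) => (s i).indicator (f i) (x i))
    (iIndepFun_pi fun i => ((hf i).indicator (hs i)).aemeasurable)
    (fun i => ((hf i).indicator (hs i)).comp (measurable_pi_apply i))]
  refine Finset.prod_congr rfl fun i _ => ?_
  rw [← gaussianReal_withDensity_exp (h i), withDensity_apply _ (hs i),
    ← lintegral_indicator (hs i)]
  exact (measurePreserving_eval (fun _ : ι => gaussianReal 0 1) i).lintegral_comp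
    ((hf i).indicator (hs i))

variable {ι : Type*} [Fintype ι]

/-- Cameron–Martin formula for the standard Gaussian measure. -/
lemma lintegral_stdGaussian_shift (h : EuclideanSpace ℝ ι) {g : EuclideanSpace ℝ ι → ℝ≥0∞}
    (hg : Measurable g) :
    ∫⁻ z, g z ∂stdGaussian (EuclideanSpace ℝ ι) =
      ∫⁻ z, g (z + h) * ENNReal.ofReal (Real.exp (-inner ℝ h z - ‖h‖ ^ 2 / 2))
        ∂stdGaussian (EuclideanSpace ℝ ι) := by
  have hT : Measurable (WithLp.toLp 2 : (ι → ℝ) → EuclideanSpace ℝ ι) := by fun_prop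
  rw [← map_pi_eq_stdGaussian, lintegral_map hg hT, lintegral_map (by fun_prop) hT]
  -- `G` is `g` divided by the density of the shifted Gaussian. Translating the variable by `h`
  -- turns the exponent into `-⟨h, x⟩ - ‖h‖² / 2`.
  set G : (ι → ℝ) → ℝ≥0∞ := fun x => g (WithLp.toLp 2 x) *
    ENNReal.ofReal (Real.exp (-∑ i, (h i * x i - h i ^ 2 / 2)))
  have hG : Measurable G := by fun_prop
  have hmap : (Measure.pi fun _ : ι => gaussianReal 0 1).map (fun x i => x i + h i) =
      Measure.pi fun i => gaussianReal (h i) 1 := by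
    have : ∀ i, SigmaFinite ((gaussianReal 0 1).map fun x => x + h i) := fun i => by
      rw [gaussianReal_map_add_const]; infer_instance
    rw [Measure.pi_map_pi (f := fun i x => x + h i) fun i => by fun_prop]
    simp_rw [gaussianReal_map_add_const, zero_add]
  calc ∫⁻ x, g (WithLp.toLp 2 x) ∂(Measure.pi fun _ : ι => gaussianReal 0 1)
      = ∫⁻ x, G x ∂(Measure.pi fun i => gaussianReal (h i) 1) := by
        rw [← pi_gaussianReal_withDensity_exp (fun i => h i),
          lintegral_withDensity_eq_lintegral_mul _ _ hG]
        · refine lintegral_congr fun x => ?_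
          simp only [G, Pi.mul_apply]
          rw [mul_left_comm, ← ENNReal.ofReal_mul (by positivity), ← Real.exp_add]
          simp
        · fun_prop
    _ = _ := by
        rw [← hmap, lintegral_map hG (by fun_prop)]
        refine lintegral_congr fun x => ?_
        simp only [G]
        congr 4
        rw [EuclideanSpace.real_norm_sq_eq, PiLp.inner_apply, Finset.sum_div,
          ← Finset.sum_neg_distrib, ← Finset.sum_neg_distrib, ← Finset.sum_sub_distrib]
        refine Finset.sum_congr rfl fun i _ => ?_
        simp
        ring

end CameronMartin

/-! ### First and second moments of Gaussian linear forms. -/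

section Moments

variable {E : Type*} [NormedAddCommGroup E] [InnerProductSpace ℝ E] [FiniteDimensional ℝ E]
  [MeasurableSpace E] [BorelSpace E]

lemma memLp_inner_stdGaussian (w : E) :
    MemLp (fun z => inner ℝ w z) 2 (stdGaussian E) :=
  IsGaussian.memLp_dual _ (innerSL ℝ w) 2 (by simp)

lemma integral_inner_stdGaussian (w : E) : ∫ z, inner ℝ w z ∂stdGaussian E = 0 :=
  integral_strongDual_stdGaussian (innerSL ℝ w)

lemma integral_inner_sq_stdGaussian (w : E) :
    ∫ z, inner ℝ w z ^ 2 ∂stdGaussian E = ‖w‖ ^ 2 := by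
  have h := variance_dual_stdGaussian (innerSL ℝ w)
  rw [variance_of_integral_eq_zero (by fun_prop) (integral_strongDual_stdGaussian _),
    innerSL_apply_norm] at h
  simpa using h

lemma integrable_inner_add_smul_sq_stdGaussian (a w : E) (σ : ℝ) :
    Integrable (fun z => inner ℝ (a + σ • z) w ^ 2) (stdGaussian E) := by
  have : MemLp (fun z => inner ℝ (a + σ • z) w) 2 (stdGaussian E) := by
    have h := (memLp_const (inner ℝ a w)).add ((memLp_inner_stdGaussian w).const_mul σ)
    convert h using 2 with z
    simp [inner_add_left, inner_smul_right, real_inner_comm]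
  exact this.integrable_sq

lemma integral_inner_add_smul_stdGaussian (a w : E) (σ : ℝ) :
    ∫ z, inner ℝ (a + σ • z) w ∂stdGaussian E = inner ℝ a w := by
  have h1 := (memLp_inner_stdGaussian w).integrable one_le_two
  simp_rw [inner_add_left, real_inner_smul_left, real_inner_comm w]
  rw [integral_add (by fun_prop) (h1.const_mul σ), integral_const_mul, integral_inner_stdGaussian]
  simp

lemma integral_inner_add_smul_sq_stdGaussian (a w : E) (σ : ℝ) :
    ∫ z, inner ℝ (a + σ • z) w ^ 2 ∂stdGaussian E = inner ℝ a w ^ 2 + σ ^ 2 * ‖w‖ ^ 2 := by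
  have h1 := (memLp_inner_stdGaussian w).integrable one_le_two
  have h2 := (memLp_inner_stdGaussian w).integrable_sq
  have : ∀ z : E, inner ℝ (a + σ • z) w ^ 2 =
      inner ℝ a w ^ 2 + (2 * inner ℝ a w * σ) * inner ℝ w z + σ ^ 2 * inner ℝ w z ^ 2 := by
    intro z
    rw [inner_add_left, real_inner_smul_left, real_inner_comm w z]
    ring
  simp_rw [this]
  have h3 : Integrable (fun z => inner ℝ a w ^ 2 + (2 * inner ℝ a w * σ) * inner ℝ w z)
    (stdGaussian E) := (integrable_const _).add (h1.const_mul _)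
  rw [integral_add h3 (h2.const_mul _), integral_add (integrable_const _) (h1.const_mul _),
    integral_const_mul, integral_const_mul,
    integral_inner_stdGaussian, integral_inner_sq_stdGaussian]
  simp

end Moments

/-! ### Sums of outer products and their spectral norm. -/

section OuterProducts

variable {p : ℕ} {α : Type*}

/-- The sum `∑ i ∈ s, xᵢ yᵢᵀ` of outer products. -/
noncomputable def outerSum (s : Finset α) (x y : α → EuclideanSpace ℝ (Fin p)) :
    Matrix (Fin p) (Fin p) ℝ :=
  ∑ i ∈ s, Matrix.of fun a b => x i a * y i b

lemma inner_toEuclideanCLM_of_mul (a b x y : EuclideanSpace ℝ (Fin p)) :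
    inner ℝ a (Matrix.toEuclideanCLM (𝕜 := ℝ) (Matrix.of fun j k => x j * y k) b) =
      inner ℝ a x * inner ℝ b y := by
  rw [Matrix.inner_toEuclideanCLM]
  simp only [dotProduct, Matrix.mulVec, Matrix.of_apply, PiLp.inner_apply, Finset.mul_sum,
    Finset.sum_mul]
  rw [Finset.sum_comm]
  refine Finset.sum_congr rfl fun i _ => Finset.sum_congr rfl fun j _ => ?_
  simp
  ring

lemma inner_toEuclideanCLM_outerSum (s : Finset α) (x y : α → EuclideanSpace ℝ (Fin p))
    (a b : EuclideanSpace ℝ (Fin p)) :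
    inner ℝ a (Matrix.toEuclideanCLM (𝕜 := ℝ) (outerSum s x y) b) =
      ∑ i ∈ s, inner ℝ a (x i) * inner ℝ b (y i) := by
  simp only [outerSum, map_sum, _root_.sum_apply, inner_sum,
    inner_toEuclideanCLM_of_mul]

lemma l2_opNorm_le_of_forall_inner_le (A : Matrix (Fin p) (Fin p) ℝ) {K : ℝ} (hK : 0 ≤ K)
    (h : ∀ a b : EuclideanSpace ℝ (Fin p), ‖a‖ ≤ 1 → ‖b‖ ≤ 1 →
      inner ℝ a (Matrix.toEuclideanCLM (𝕜 := ℝ) A b) ≤ K) : ‖A‖ ≤ K := by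
  rw [Matrix.cstar_norm_def]
  refine ContinuousLinearMap.opNorm_le_of_unit_norm hK fun b hb => ?_
  set w := Matrix.toEuclideanCLM (𝕜 := ℝ) A b
  rcases eq_or_ne w 0 with hw | hw
  · simpa [hw] using hK
  · have := h (‖w‖⁻¹ • w) b (by rw [norm_smul]; simp [hw]) hb.le
    rw [real_inner_smul_left, real_inner_self_eq_norm_sq] at this
    have hw' : ‖w‖ ≠ 0 := by simpa using hw
    rwa [pow_two, ← mul_assoc, inv_mul_cancel₀ hw', one_mul] at this

lemma inner_toEuclideanCLM_le (A : Matrix (Fin p) (Fin p) ℝ) (a b : EuclideanSpace ℝ (Fin p)) :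
    |inner ℝ a (Matrix.toEuclideanCLM (𝕜 := ℝ) A b)| ≤ ‖A‖ * ‖a‖ * ‖b‖ := by
  refine (abs_real_inner_le_norm _ _).trans ?_
  have := (Matrix.toEuclideanCLM (𝕜 := ℝ) A).le_opNorm b
  rw [← Matrix.cstar_norm_def] at this
  nlinarith [norm_nonneg a]

lemma sum_inner_sq_le_norm_outerSum (s : Finset α) (x : α → EuclideanSpace ℝ (Fin p))
    (a : EuclideanSpace ℝ (Fin p)) (ha : ‖a‖ ≤ 1) :
    ∑ i ∈ s, inner ℝ a (x i) ^ 2 ≤ ‖outerSum s x x‖ := by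
  have h := (le_abs_self _).trans (inner_toEuclideanCLM_le (outerSum s x x) a a)
  rw [inner_toEuclideanCLM_outerSum] at h
  simp_rw [pow_two]
  refine h.trans ?_
  have h0 := norm_nonneg (outerSum s x x)
  have : ‖a‖ * ‖a‖ ≤ 1 := mul_le_one₀ ha (norm_nonneg _) ha
  nlinarith

lemma norm_outerSum_le (s : Finset α) (x y : α → EuclideanSpace ℝ (Fin p)) :
    ‖outerSum s x y‖ ≤ ∑ i ∈ s, ‖x i‖ * ‖y i‖ := by
  refine l2_opNorm_le_of_forall_inner_le _ (by positivity) fun a b ha hb => ?_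
  rw [inner_toEuclideanCLM_outerSum]
  refine Finset.sum_le_sum fun i _ => ?_
  refine (le_abs_self _).trans ?_
  rw [abs_mul]
  have h1 := abs_real_inner_le_norm a (x i)
  have h2 := abs_real_inner_le_norm b (y i)
  refine mul_le_mul (h1.trans ?_) (h2.trans ?_) (abs_nonneg _) (norm_nonneg _)
  · exact mul_le_of_le_one_left (norm_nonneg _) ha
  · exact mul_le_of_le_one_left (norm_nonneg _) hb

lemma continuous_outerSum {X : Type*} [TopologicalSpace X] (s : Finset α)
    {x y : α → X → EuclideanSpace ℝ (Fin p)} (hx : ∀ i, Continuous (x i))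
    (hy : ∀ i, Continuous (y i)) :
    Continuous fun w => outerSum s (fun i => x i w) (fun i => y i w) := by
  refine continuous_finsetSum _ fun i _ => continuous_matrix fun a b => ?_
  have := hx i
  have := hy i
  simp only [Matrix.of_apply]
  fun_prop

end OuterProducts

lemma ofReal_integral_le_lintegral_ofReal {X : Type*} [MeasurableSpace X] {μ : Measure X}
    {f : X → ℝ} (hf : Integrable f μ) :
    ENNReal.ofReal (∫ x, f x ∂μ) ≤ ∫⁻ x, ENNReal.ofReal (f x) ∂μ := by
  rw [integral_eq_lintegral_pos_part_sub_lintegral_neg_part hf]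
  exact (ENNReal.ofReal_le_ofReal (sub_le_self _ ENNReal.toReal_nonneg)).trans
    ENNReal.ofReal_toReal_le

/-! ### Variational lower bound by shifting a Gaussian prior. -/

section Variational

variable {p : ℕ} {α : Type*}

/-- The bilinear form `l ∑ ⟨a, xᵢ⟩⟨b, yᵢ⟩`, compensated by half of the variance bound
`l² ∑ ⟨a, xᵢ⟩² q(b)`. -/
noncomputable def compensatedForm (s : Finset α) (q : EuclideanSpace ℝ (Fin p) → ℝ) (l : ℝ)
    (x y : α → EuclideanSpace ℝ (Fin p)) (a b : EuclideanSpace ℝ (Fin p)) : ℝ :=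
  l * ∑ i ∈ s, inner ℝ a (x i) * inner ℝ b (y i) -
    l ^ 2 / 2 * ((∑ i ∈ s, inner ℝ a (x i) ^ 2) * q b)

/-- The Gaussian average of the exponential of the compensated form. -/
noncomputable def gibbsIntegral (s : Finset α) (q : EuclideanSpace ℝ (Fin p) → ℝ) (l σ : ℝ)
    (x y : α → EuclideanSpace ℝ (Fin p)) : ℝ≥0∞ :=
  ∫⁻ z, ∫⁻ w, ENNReal.ofReal (Real.exp (compensatedForm s q l x y (σ • z) (σ • w)))
    ∂stdGaussian (EuclideanSpace ℝ (Fin p)) ∂stdGaussian (EuclideanSpace ℝ (Fin p))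

/-- The two perturbations are independent and centred, so the bilinear term is unchanged on average;
only the squares pick up the trace term `σ² ∑ ‖xᵢ‖²`. The function `q` enters solely through its
Gaussian smoothing, which is why it can stay abstract. -/
lemma integral_compensatedForm (s : Finset α) (q : EuclideanSpace ℝ (Fin p) → ℝ) (l σ : ℝ)
    (x y : α → EuclideanSpace ℝ (Fin p)) (a b : EuclideanSpace ℝ (Fin p))
    (hq : Integrable (fun w => q (b + σ • w)) (stdGaussian (EuclideanSpace ℝ (Fin p)))) :
    Integrable (fun v : EuclideanSpace ℝ (Fin p) × EuclideanSpace ℝ (Fin p) =>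
      compensatedForm s q l x y (a + σ • v.1) (b + σ • v.2))
      ((stdGaussian (EuclideanSpace ℝ (Fin p))).prod (stdGaussian (EuclideanSpace ℝ (Fin p)))) ∧
    ∫ v : EuclideanSpace ℝ (Fin p) × EuclideanSpace ℝ (Fin p),
      compensatedForm s q l x y (a + σ • v.1) (b + σ • v.2)
      ∂(stdGaussian (EuclideanSpace ℝ (Fin p))).prod (stdGaussian (EuclideanSpace ℝ (Fin p))) =
      l * ∑ i ∈ s, inner ℝ a (x i) * inner ℝ b (y i) -
        l ^ 2 / 2 * ((∑ i ∈ s, inner ℝ a (x i) ^ 2 + σ ^ 2 * ∑ i ∈ s, ‖x i‖ ^ 2) *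
          ∫ w, q (b + σ • w) ∂stdGaussian (EuclideanSpace ℝ (Fin p))) := by
  set γ := stdGaussian (EuclideanSpace ℝ (Fin p))
  have hL : ∀ a w : EuclideanSpace ℝ (Fin p),
      Integrable (fun z => inner ℝ (a + σ • z) w) γ := fun a w => by
    simp_rw [inner_add_left, real_inner_smul_left, real_inner_comm w]
    exact (integrable_const _).add
      (((memLp_inner_stdGaussian w).integrable one_le_two).const_mul σ)
  have h1 : ∀ i, Integrable (fun v : EuclideanSpace ℝ (Fin p) × EuclideanSpace ℝ (Fin p) =>
      inner ℝ (a + σ • v.1) (x i) * inner ℝ (b + σ • v.2) (y i)) (γ.prod γ) := fun i =>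
    (hL a (x i)).mul_prod (hL b (y i))
  have h2 : Integrable (fun z => ∑ i ∈ s, inner ℝ (a + σ • z) (x i) ^ 2) γ :=
    integrable_finsetSum _ fun i _ => integrable_inner_add_smul_sq_stdGaussian a (x i) σ
  have h3 : Integrable (fun v : EuclideanSpace ℝ (Fin p) × EuclideanSpace ℝ (Fin p) =>
      (∑ i ∈ s, inner ℝ (a + σ • v.1) (x i) ^ 2) * q (b + σ • v.2)) (γ.prod γ) :=
    h2.mul_prod hq
  have h4 := (integrable_finsetSum s fun i _ => h1 i).const_mul l
  have h5 := h3.const_mul (l ^ 2 / 2)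
  refine ⟨h4.sub h5, ?_⟩
  simp only [compensatedForm]
  rw [integral_sub h4 h5, integral_const_mul, integral_const_mul,
    integral_finsetSum _ fun i _ => h1 i,
    integral_prod_mul (fun z => ∑ i ∈ s, inner ℝ (a + σ • z) (x i) ^ 2) fun w => q (b + σ • w),
    integral_finsetSum _ fun i _ => integrable_inner_add_smul_sq_stdGaussian a (x i) σ]
  have e1 : ∑ i ∈ s, ∫ v : EuclideanSpace ℝ (Fin p) × EuclideanSpace ℝ (Fin p),
      inner ℝ (a + σ • v.1) (x i) * inner ℝ (b + σ • v.2) (y i) ∂γ.prod γ =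
      ∑ i ∈ s, inner ℝ a (x i) * inner ℝ b (y i) := Finset.sum_congr rfl fun i _ => by
    rw [integral_prod_mul (fun z => inner ℝ (a + σ • z) (x i))
      fun w => inner ℝ (b + σ • w) (y i)]
    simp only [γ, integral_inner_add_smul_stdGaussian]
  rw [e1]
  simp only [γ, integral_inner_add_smul_sq_stdGaussian, Finset.sum_add_distrib, Finset.mul_sum]

lemma measurable_compensatedForm {X : Type*} [MeasurableSpace X] (s : Finset α)
    {q : EuclideanSpace ℝ (Fin p) → ℝ} (hqm : Measurable q) (l : ℝ)
    {x y : α → X → EuclideanSpace ℝ (Fin p)} {a b : X → EuclideanSpace ℝ (Fin p)}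
    (hx : ∀ i, Measurable (x i)) (hy : ∀ i, Measurable (y i)) (ha : Measurable a)
    (hb : Measurable b) :
    Measurable fun w => compensatedForm s q l (fun i => x i w) (fun i => y i w) (a w) (b w) := by
  unfold compensatedForm
  fun_prop

lemma lintegral_stdGaussian_shift₂ (h k : EuclideanSpace ℝ (Fin p))
    {G : EuclideanSpace ℝ (Fin p) → EuclideanSpace ℝ (Fin p) → ℝ≥0∞}
    (hG : Measurable (Function.uncurry G)) :
    ∫⁻ z, ∫⁻ w, G z w ∂stdGaussian (EuclideanSpace ℝ (Fin p))
        ∂stdGaussian (EuclideanSpace ℝ (Fin p)) =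
      ∫⁻ t : EuclideanSpace ℝ (Fin p) × EuclideanSpace ℝ (Fin p), G (t.1 + h) (t.2 + k) *
          ENNReal.ofReal (Real.exp (-inner ℝ h t.1 - ‖h‖ ^ 2 / 2)) *
          ENNReal.ofReal (Real.exp (-inner ℝ k t.2 - ‖k‖ ^ 2 / 2))
        ∂(stdGaussian (EuclideanSpace ℝ (Fin p))).prod
          (stdGaussian (EuclideanSpace ℝ (Fin p))) := by
  have hG' : Measurable fun t : EuclideanSpace ℝ (Fin p) × EuclideanSpace ℝ (Fin p) =>
      G (t.1 + h) (t.2 + k) :=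
    hG.comp ((measurable_fst.add_const h).prodMk (measurable_snd.add_const k))
  rw [lintegral_prod _ (by fun_prop), lintegral_stdGaussian_shift h
    (g := fun z => ∫⁻ w, G z w ∂stdGaussian (EuclideanSpace ℝ (Fin p))) hG.lintegral_prod_right']
  refine lintegral_congr fun z => ?_
  rw [← lintegral_mul_const' _ _ (by simp)]
  have hz : Measurable fun w => G (z + h) w := hG.comp measurable_prodMk_left
  rw [lintegral_stdGaussian_shift k (hz.mul_const _)]

lemma integral_log_shift_fst (h : EuclideanSpace ℝ (Fin p)) :
    Integrable (fun t : EuclideanSpace ℝ (Fin p) × EuclideanSpace ℝ (Fin p) =>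
      -inner ℝ h t.1 - ‖h‖ ^ 2 / 2) ((stdGaussian (EuclideanSpace ℝ (Fin p))).prod
        (stdGaussian (EuclideanSpace ℝ (Fin p)))) ∧
    ∫ t : EuclideanSpace ℝ (Fin p) × EuclideanSpace ℝ (Fin p),
      (-inner ℝ h t.1 - ‖h‖ ^ 2 / 2) ∂(stdGaussian (EuclideanSpace ℝ (Fin p))).prod
        (stdGaussian (EuclideanSpace ℝ (Fin p))) = -(‖h‖ ^ 2 / 2) := by
  have h1 : Integrable (fun z => -inner ℝ h z - ‖h‖ ^ 2 / 2)
      (stdGaussian (EuclideanSpace ℝ (Fin p))) :=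
    ((memLp_inner_stdGaussian h).integrable one_le_two).neg.sub (integrable_const _)
  refine ⟨h1.comp_fst _, ?_⟩
  rw [integral_fun_fst (f := fun z => -inner ℝ h z - ‖h‖ ^ 2 / 2),
    integral_sub (f := fun z => -inner ℝ h z)
    (((memLp_inner_stdGaussian h).integrable one_le_two).neg) (integrable_const _), integral_neg,
    integral_inner_stdGaussian]
  simp

lemma integral_log_shift_snd (h : EuclideanSpace ℝ (Fin p)) :
    Integrable (fun t : EuclideanSpace ℝ (Fin p) × EuclideanSpace ℝ (Fin p) =>
      -inner ℝ h t.2 - ‖h‖ ^ 2 / 2) ((stdGaussian (EuclideanSpace ℝ (Fin p))).prod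
        (stdGaussian (EuclideanSpace ℝ (Fin p)))) ∧
    ∫ t : EuclideanSpace ℝ (Fin p) × EuclideanSpace ℝ (Fin p),
      (-inner ℝ h t.2 - ‖h‖ ^ 2 / 2) ∂(stdGaussian (EuclideanSpace ℝ (Fin p))).prod
        (stdGaussian (EuclideanSpace ℝ (Fin p))) = -(‖h‖ ^ 2 / 2) := by
  have h1 : Integrable (fun z => -inner ℝ h z - ‖h‖ ^ 2 / 2)
      (stdGaussian (EuclideanSpace ℝ (Fin p))) :=
    ((memLp_inner_stdGaussian h).integrable one_le_two).neg.sub (integrable_const _)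
  refine ⟨h1.comp_snd _, ?_⟩
  rw [integral_fun_snd (f := fun z => -inner ℝ h z - ‖h‖ ^ 2 / 2),
    integral_sub (f := fun z => -inner ℝ h z)
    (((memLp_inner_stdGaussian h).integrable one_le_two).neg) (integrable_const _), integral_neg,
    integral_inner_stdGaussian]
  simp

/-- Recentre both Gaussians at `(a, b)`, that is, shift the standard variables by `σ⁻¹ a` and `σ⁻¹
b`, and bound the resulting exponential below by `1 + x`. The mean of the log-density is minus the
relative entropy `(‖a‖² + ‖b‖²) / (2σ²)`. The right-hand side does not involve `a` or `b`, which
gives uniformity over directions. -/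
lemma le_gibbsIntegral (s : Finset α) {q : EuclideanSpace ℝ (Fin p) → ℝ} (hqm : Measurable q)
    (l : ℝ) {σ : ℝ} (hσ : 0 < σ) (x y : α → EuclideanSpace ℝ (Fin p))
    (a b : EuclideanSpace ℝ (Fin p))
    (hq : Integrable (fun w => q (b + σ • w)) (stdGaussian (EuclideanSpace ℝ (Fin p)))) :
    ENNReal.ofReal (1 + l * ∑ i ∈ s, inner ℝ a (x i) * inner ℝ b (y i) -
        l ^ 2 / 2 * ((∑ i ∈ s, inner ℝ a (x i) ^ 2 + σ ^ 2 * ∑ i ∈ s, ‖x i‖ ^ 2) *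
          ∫ w, q (b + σ • w) ∂stdGaussian (EuclideanSpace ℝ (Fin p))) -
        (‖a‖ ^ 2 + ‖b‖ ^ 2) / (2 * σ ^ 2)) ≤ gibbsIntegral s q l σ x y := by
  obtain ⟨hi, hint⟩ := integral_compensatedForm s q l σ x y a b hq
  set h := σ⁻¹ • a with hh
  set k := σ⁻¹ • b with hk
  have hσh : ∀ z, σ • (z + h) = a + σ • z := fun z => by
    rw [smul_add, hh, smul_smul, mul_inv_cancel₀ hσ.ne', one_smul, add_comm]
  have hσk : ∀ z, σ • (z + k) = b + σ • z := fun z => by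
    rw [smul_add, hk, smul_smul, mul_inv_cancel₀ hσ.ne', one_smul, add_comm]
  have hnh : ‖h‖ ^ 2 = ‖a‖ ^ 2 / σ ^ 2 := by
    rw [hh, norm_smul, mul_pow, norm_inv, inv_pow, Real.norm_eq_abs, sq_abs]; ring
  have hnk : ‖k‖ ^ 2 = ‖b‖ ^ 2 / σ ^ 2 := by
    rw [hk, norm_smul, mul_pow, norm_inv, inv_pow, Real.norm_eq_abs, sq_abs]; ring
  have hm : ∀ u v : EuclideanSpace ℝ (Fin p), Measurable
      fun t : EuclideanSpace ℝ (Fin p) × EuclideanSpace ℝ (Fin p) =>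
      compensatedForm s q l x y (u + σ • t.1) (v + σ • t.2) := fun u v =>
    measurable_compensatedForm s hqm l (x := fun i _ => x i) (y := fun i _ => y i)
      (fun i => measurable_const) (fun i => measurable_const) (by fun_prop) (by fun_prop)
  have hshift : gibbsIntegral s q l σ x y = ∫⁻ t : EuclideanSpace ℝ (Fin p) ×
      EuclideanSpace ℝ (Fin p), ENNReal.ofReal (Real.exp
        (compensatedForm s q l x y (a + σ • t.1) (b + σ • t.2) +
          (-inner ℝ h t.1 - ‖h‖ ^ 2 / 2) + (-inner ℝ k t.2 - ‖k‖ ^ 2 / 2)))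
      ∂(stdGaussian (EuclideanSpace ℝ (Fin p))).prod
        (stdGaussian (EuclideanSpace ℝ (Fin p))) := by
    have h0 := hm 0 0
    simp only [zero_add] at h0
    unfold gibbsIntegral
    rw [lintegral_stdGaussian_shift₂ h k (G := fun z w => ENNReal.ofReal (Real.exp
      (compensatedForm s q l x y (σ • z) (σ • w)))) h0.exp.ennreal_ofReal]
    refine lintegral_congr fun t => ?_
    rw [hσh, hσk, Real.exp_add, Real.exp_add, ENNReal.ofReal_mul (by positivity),
      ENNReal.ofReal_mul (by positivity)]
  rw [hshift]
  obtain ⟨i1, hh0⟩ := integral_log_shift_fst h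
  obtain ⟨i2, hk0⟩ := integral_log_shift_snd k
  have i3 : Integrable (fun t : EuclideanSpace ℝ (Fin p) × EuclideanSpace ℝ (Fin p) =>
      compensatedForm s q l x y (a + σ • t.1) (b + σ • t.2) +
          (-inner ℝ h t.1 - ‖h‖ ^ 2 / 2))
      ((stdGaussian (EuclideanSpace ℝ (Fin p))).prod
        (stdGaussian (EuclideanSpace ℝ (Fin p)))) := hi.add i1
  have i4 : Integrable (fun t : EuclideanSpace ℝ (Fin p) × EuclideanSpace ℝ (Fin p) =>
      compensatedForm s q l x y (a + σ • t.1) (b + σ • t.2) +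
          (-inner ℝ h t.1 - ‖h‖ ^ 2 / 2) + (-inner ℝ k t.2 - ‖k‖ ^ 2 / 2))
      ((stdGaussian (EuclideanSpace ℝ (Fin p))).prod
        (stdGaussian (EuclideanSpace ℝ (Fin p)))) :=
    i3.add i2
  have i5 : Integrable (fun t : EuclideanSpace ℝ (Fin p) × EuclideanSpace ℝ (Fin p) =>
      compensatedForm s q l x y (a + σ • t.1) (b + σ • t.2) +
          (-inner ℝ h t.1 - ‖h‖ ^ 2 / 2) + (-inner ℝ k t.2 - ‖k‖ ^ 2 / 2) + 1)
      ((stdGaussian (EuclideanSpace ℝ (Fin p))).prod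
        (stdGaussian (EuclideanSpace ℝ (Fin p)))) :=
    i4.add (integrable_const _)
  refine le_trans (le_of_eq ?_) ((ofReal_integral_le_lintegral_ofReal i5).trans
    (lintegral_mono fun t => ENNReal.ofReal_le_ofReal (Real.add_one_le_exp _)))
  rw [integral_add i4 (integrable_const _), integral_add i3 i2, integral_add hi i1, hint,
    hh0, hk0, hnh, hnk]
  congr 1
  simp
  ring

end Variational

lemma lintegral_lintegral_lintegral_rotate {X Y Z : Type*} [MeasurableSpace X] [MeasurableSpace Y]
    [MeasurableSpace Z] {μ : Measure X} {ν : Measure Y} {ρ : Measure Z} [SFinite μ] [SFinite ν]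
    [SFinite ρ] {f : X → Y → Z → ℝ≥0∞} (hf : Measurable fun t : X × Y × Z => f t.1 t.2.1 t.2.2) :
    ∫⁻ x, ∫⁻ y, ∫⁻ z, f x y z ∂ρ ∂ν ∂μ = ∫⁻ y, ∫⁻ z, ∫⁻ x, f x y z ∂μ ∂ρ ∂ν := by
  rw [lintegral_lintegral_swap]
  · refine lintegral_congr fun y => lintegral_lintegral_swap ?_
    exact (hf.comp (by fun_prop : Measurable fun t : X × Z => (t.1, y, t.2))).aemeasurable
  · refine Measurable.aemeasurable (Measurable.lintegral_prod_right'
      (f := fun t : (X × Y) × Z => f t.1.1 t.1.2 t.2) ?_)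
    exact hf.comp (by fun_prop : Measurable fun t : (X × Y) × Z => (t.1.1, t.1.2, t.2))

/-! ### Expected norm of a decoupled Gaussian bilinear sum. -/

section GaussianBilinear

variable {p : ℕ} {α H : Type*} [NormedAddCommGroup H] [NormedSpace ℝ H] [MeasurableSpace H]
  [BorelSpace H] [SecondCountableTopology H]

lemma lintegral_exp_mul_dual_le {μ : Measure H} [IsGaussian μ] (hμ : ∫ v, id v ∂μ = 0)
    [CompleteSpace H] (L : StrongDual ℝ H) (l : ℝ) {C : ℝ} (hC : l ^ 2 / 2 * ∫ v, L v ^ 2 ∂μ ≤ C) :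
    ∫⁻ v, ENNReal.ofReal (Real.exp (l * L v - C)) ∂μ ≤ 1 := by
  have hmean : μ[L] = 0 := by rw [IsGaussian.integral_dual]; simpa using congrArg L hμ
  have hvar : Var[L; μ] = ∫ v, L v ^ 2 ∂μ := by
    rw [variance_of_integral_eq_zero (by fun_prop) hmean]
  have hmap := IsGaussian.map_eq_gaussianReal (μ := μ) L
  have hint : Integrable (fun v => Real.exp (l * L v)) μ := by
    have h := integrable_exp_mul_gaussianReal (μ := μ[L]) (v := Var[L; μ].toNNReal) l
    rw [← hmap] at h
    exact h.comp_aemeasurable (by fun_prop)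
  have hmgf := mgf_gaussianReal hmap l
  have h0 : 0 ≤ ∫ v, L v ^ 2 ∂μ := integral_nonneg fun v => sq_nonneg _
  rw [mgf, hmean, hvar, Real.coe_toNNReal _ h0] at hmgf
  have e : ∀ v, Real.exp (l * L v - C) = Real.exp (-C) * Real.exp (l * L v) := fun v => by
    rw [← Real.exp_add]; ring_nf
  simp_rw [e]
  rw [← ofReal_integral_eq_lintegral_ofReal (hint.const_mul _)
    (Filter.Eventually.of_forall fun v => by positivity), integral_const_mul, hmgf,
    ← Real.exp_add, ENNReal.ofReal_le_one, Real.exp_le_one_iff]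
  linarith

/-- By Tonelli the average over `v` can be taken first. For fixed directions the exponent is a
centred Gaussian minus at least half its variance, so its exponential has mean at most 1. -/
lemma lintegral_gibbsIntegral_le_one {μ : Measure H} [IsGaussian μ] (hμ : ∫ v, id v ∂μ = 0)
    [CompleteSpace H] (s : Finset α) {q : EuclideanSpace ℝ (Fin p) → ℝ} (hqm : Measurable q)
    (l σ : ℝ) (x : α → EuclideanSpace ℝ (Fin p)) (V : α → H →L[ℝ] EuclideanSpace ℝ (Fin p))
    (hV : ∀ (c : α → ℝ) (b : EuclideanSpace ℝ (Fin p)),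
      ∫ v, (∑ i ∈ s, c i * inner ℝ b (V i v)) ^ 2 ∂μ ≤ (∑ i ∈ s, c i ^ 2) * q b) :
    ∫⁻ v, gibbsIntegral s q l σ x (fun i => V i v) ∂μ ≤ 1 := by
  have hm : Measurable fun t : H × EuclideanSpace ℝ (Fin p) × EuclideanSpace ℝ (Fin p) =>
      ENNReal.ofReal (Real.exp
        (compensatedForm s q l x (fun i => V i t.1) (σ • t.2.1) (σ • t.2.2))) := by
    have h0 := measurable_compensatedForm s hqm l (x := fun i _ => x i)
      (y := fun i (t : H × EuclideanSpace ℝ (Fin p) × EuclideanSpace ℝ (Fin p)) => V i t.1)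
      (a := fun t => σ • t.2.1) (b := fun t => σ • t.2.2)
      (fun i => measurable_const) (fun i => by fun_prop) (by fun_prop) (by fun_prop)
    exact h0.exp.ennreal_ofReal
  unfold gibbsIntegral
  rw [lintegral_lintegral_lintegral_rotate (f := fun v z w => ENNReal.ofReal (Real.exp
    (compensatedForm s q l x (fun i => V i v) (σ • z) (σ • w)))) hm]
  refine (lintegral_mono fun z => (lintegral_mono fun w => ?_).trans
    (lintegral_const (1 : ℝ≥0∞)).le).trans ((lintegral_const _).trans (by simp)).le
  set L : StrongDual ℝ H :=
    ∑ i ∈ s, inner ℝ (σ • z) (x i) • (innerSL ℝ (σ • w)).comp (V i) with hL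
  have hLv : ∀ v, L v = ∑ i ∈ s, inner ℝ (σ • z) (x i) * inner ℝ (σ • w) (V i v) := fun v => by
    simp [hL, innerSL_apply_apply ℝ, real_inner_smul_left]
  have := lintegral_exp_mul_dual_le hμ L l
    (C := l ^ 2 / 2 * ((∑ i ∈ s, inner ℝ (σ • z) (x i) ^ 2) * q (σ • w))) (by
      simp_rw [hLv]
      exact mul_le_mul_of_nonneg_left (hV _ _) (by positivity))
  simpa only [hLv, compensatedForm] using this

lemma memLp_two_clm {μ : Measure H} [IsGaussian μ] [CompleteSpace H]
    (U : H →L[ℝ] EuclideanSpace ℝ (Fin p)) : MemLp (fun u => U u) 2 μ :=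
  U.comp_memLp' IsGaussian.memLp_two_id

lemma integrable_norm_outerSum_prod {μ : Measure H} [IsGaussian μ] [CompleteSpace H]
    (s : Finset α) (U V : α → H →L[ℝ] EuclideanSpace ℝ (Fin p)) :
    Integrable (fun t : H × H => ‖outerSum s (fun i => U i t.1) (fun i => V i t.2)‖)
      (μ.prod μ) := by
  have hc : Continuous fun t : H × H =>
      ‖outerSum s (fun i => U i t.1) (fun i => V i t.2)‖ :=
    (continuous_outerSum s (x := fun i (t : H × H) => U i t.1) (y := fun i t => V i t.2)
      (fun i => by fun_prop) (fun i => by fun_prop)).norm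
  refine Integrable.mono' (integrable_finsetSum s fun i _ =>
    ((memLp_two_clm (μ := μ) (U i)).integrable one_le_two).norm.mul_prod
      ((memLp_two_clm (μ := μ) (V i)).integrable one_le_two).norm)
    hc.aestronglyMeasurable (Filter.Eventually.of_forall fun t => ?_)
  rw [norm_norm]
  exact norm_outerSum_le _ _ _

lemma integrable_norm_outerSum {μ : Measure H} [IsGaussian μ] [CompleteSpace H]
    (s : Finset α) (U V : α → H →L[ℝ] EuclideanSpace ℝ (Fin p)) :
    Integrable (fun u : H => ‖outerSum s (fun i => U i u) (fun i => V i u)‖) μ := by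
  have hc : Continuous fun u : H =>
      ‖outerSum s (fun i => U i u) (fun i => V i u)‖ :=
    (continuous_outerSum s (fun i => by fun_prop) (fun i => by fun_prop)).norm
  refine Integrable.mono' (integrable_finsetSum s fun i _ =>
    (memLp_two_clm (μ := μ) (U i)).norm.integrable_mul
      (memLp_two_clm (μ := μ) (V i)).norm)
    hc.aestronglyMeasurable (Filter.Eventually.of_forall fun t => ?_)
  rw [norm_norm]
  exact norm_outerSum_le _ _ _

/-- Variational bound for the spectral norm of `∑ Uᵢ Vᵢᵀ` with independent Gaussian `U`, `V`. -/
theorem integral_norm_outerSum_prod_le {μ : Measure H} [IsGaussian μ] (hμ : ∫ v, id v ∂μ = 0)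
    [CompleteSpace H] (s : Finset α) {q : EuclideanSpace ℝ (Fin p) → ℝ} (hqm : Measurable q)
    {l σ B : ℝ} (hl : 0 < l) (hσ : 0 < σ) (hB : 0 ≤ B)
    (U V : α → H →L[ℝ] EuclideanSpace ℝ (Fin p))
    (hV : ∀ (c : α → ℝ) (b : EuclideanSpace ℝ (Fin p)),
      ∫ v, (∑ i ∈ s, c i * inner ℝ b (V i v)) ^ 2 ∂μ ≤ (∑ i ∈ s, c i ^ 2) * q b)
    (hqi : ∀ b, Integrable (fun w => q (b + σ • w)) (stdGaussian (EuclideanSpace ℝ (Fin p))))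
    (hqB : ∀ b, ‖b‖ ≤ 1 → ∫ w, q (b + σ • w) ∂stdGaussian (EuclideanSpace ℝ (Fin p)) ≤ B) :
    l * ∫ t : H × H, ‖outerSum s (fun i => U i t.1) (fun i => V i t.2)‖ ∂μ.prod μ ≤
      l ^ 2 / 2 * B * (∫ u, ‖outerSum s (fun i => U i u) (fun i => U i u)‖ ∂μ +
        σ ^ 2 * ∑ i ∈ s, ∫ u, ‖U i u‖ ^ 2 ∂μ) + 1 / σ ^ 2 := by
  set Z : H × H → ℝ≥0∞ := fun t => gibbsIntegral s q l σ (fun i => U i t.1) (fun i => V i t.2)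
    with hZ
  have hZm : Measurable Z := by
    have hm : Measurable fun t : ((H × H) × EuclideanSpace ℝ (Fin p)) × EuclideanSpace ℝ (Fin p) =>
        ENNReal.ofReal (Real.exp (compensatedForm s q l (fun i => U i t.1.1.1)
          (fun i => V i t.1.1.2) (σ • t.1.2) (σ • t.2))) := by
      have h0 := measurable_compensatedForm s hqm l
        (x := fun i (t : ((H × H) × EuclideanSpace ℝ (Fin p)) × EuclideanSpace ℝ (Fin p)) =>
          U i t.1.1.1)
        (y := fun i t => V i t.1.1.2) (a := fun t => σ • t.1.2) (b := fun t => σ • t.2)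
        (fun i => by fun_prop) (fun i => by fun_prop) (by fun_prop) (by fun_prop)
      exact h0.exp.ennreal_ofReal
    exact Measurable.lintegral_prod_right' (Measurable.lintegral_prod_right' hm)
  -- Independence enters here: the bound holds for each frozen value of the first factor.
  have hZ1 : ∫⁻ t, Z t ∂μ.prod μ ≤ 1 := by
    rw [lintegral_prod _ hZm.aemeasurable]
    refine (lintegral_mono fun u => lintegral_gibbsIntegral_le_one hμ s hqm l σ
      (fun i => U i u) V hV).trans ?_
    simp
  have hZtop : ∫⁻ t, Z t ∂μ.prod μ ≠ ∞ := (hZ1.trans_lt ENNReal.one_lt_top).ne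
  have hZae : ∀ᵐ t ∂μ.prod μ, Z t < ∞ := ae_lt_top hZm hZtop
  have hZi : Integrable (fun t => (Z t).toReal) (μ.prod μ) :=
    integrable_toReal_of_lintegral_ne_top hZm.aemeasurable hZtop
  have hZint : ∫ t, (Z t).toReal ∂μ.prod μ ≤ 1 := by
    rw [integral_toReal hZm.aemeasurable hZae]
    exact ENNReal.toReal_le_of_le_ofReal zero_le_one (by simpa using hZ1)
  set R : H → ℝ := fun u => l ^ 2 / 2 * B * (‖outerSum s (fun i => U i u) (fun i => U i u)‖ +
    σ ^ 2 * ∑ i ∈ s, ‖U i u‖ ^ 2) + 1 / σ ^ 2 with hR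
  have hS : ∀ i, Integrable (fun u => ‖U i u‖ ^ 2) μ := fun i =>
    (memLp_two_clm (μ := μ) (U i)).integrable_norm_pow (by norm_num)
  have hRi : Integrable R μ :=
    (((integrable_norm_outerSum s U U).add
      ((integrable_finsetSum s fun i _ => hS i).const_mul _)).const_mul _).add (integrable_const _)
  have hRint : ∫ u, R u ∂μ = l ^ 2 / 2 * B *
      (∫ u, ‖outerSum s (fun i => U i u) (fun i => U i u)‖ ∂μ +
        σ ^ 2 * ∑ i ∈ s, ∫ u, ‖U i u‖ ^ 2 ∂μ) + 1 / σ ^ 2 := by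
    have h1 := (integrable_finsetSum s fun i _ => hS i).const_mul (σ ^ 2)
    have h2 := ((integrable_norm_outerSum (μ := μ) s U U).add h1).const_mul (l ^ 2 / 2 * B)
    simp only [Pi.add_apply] at h2
    rw [hR, integral_add h2 (integrable_const _), integral_const_mul,
      integral_add (integrable_norm_outerSum s U U) h1, integral_const_mul,
      integral_finsetSum _ fun i _ => hS i]
    simp
  -- The variational bound, with its right-hand side made independent of `a` and `b`. After
  -- integration `Z - 1` contributes at most 0, so only `R` survives.
  have hpt : ∀ t : H × H, Z t < ∞ → ∀ a b : EuclideanSpace ℝ (Fin p), ‖a‖ ≤ 1 → ‖b‖ ≤ 1 →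
      l * ∑ i ∈ s, inner ℝ a (U i t.1) * inner ℝ b (V i t.2) ≤ (Z t).toReal - 1 + R t.1 := by
    intro t ht a b ha hb
    have h := le_gibbsIntegral s hqm l hσ (fun i => U i t.1) (fun i => V i t.2) a b (hqi b)
    rw [ENNReal.ofReal_le_iff_le_toReal ht.ne] at h
    have h1 := sum_inner_sq_le_norm_outerSum s (fun i => U i t.1) a ha
    have h2 : (∑ i ∈ s, inner ℝ a (U i t.1) ^ 2 + σ ^ 2 * ∑ i ∈ s, ‖U i t.1‖ ^ 2) *
        ∫ w, q (b + σ • w) ∂stdGaussian (EuclideanSpace ℝ (Fin p)) ≤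
        (‖outerSum s (fun i => U i t.1) (fun i => U i t.1)‖ +
          σ ^ 2 * ∑ i ∈ s, ‖U i t.1‖ ^ 2) * B :=
      (mul_le_mul_of_nonneg_left (hqB b hb) (by positivity)).trans
        (mul_le_mul_of_nonneg_right (by linarith) hB)
    have h3 : (‖a‖ ^ 2 + ‖b‖ ^ 2) / (2 * σ ^ 2) ≤ 1 / σ ^ 2 := by
      rw [div_le_div_iff₀ (by positivity) (by positivity)]
      have : ‖a‖ ^ 2 ≤ 1 := pow_le_one₀ (norm_nonneg _) ha
      have : ‖b‖ ^ 2 ≤ 1 := pow_le_one₀ (norm_nonneg _) hb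
      have : 0 < σ ^ 2 := by positivity
      nlinarith
    have h4 := mul_le_mul_of_nonneg_left h2 (by positivity : 0 ≤ l ^ 2 / 2)
    simp only [hR, hZ] at h ⊢
    linarith
  have hae : ∀ᵐ t ∂μ.prod μ, l * ‖outerSum s (fun i => U i t.1) (fun i => V i t.2)‖ ≤
      (Z t).toReal - 1 + R t.1 := by
    filter_upwards [hZae] with t ht
    rw [← le_div_iff₀' hl]
    refine l2_opNorm_le_of_forall_inner_le _ ?_ fun a b ha hb => ?_
    -- Taking `a = b = 0` shows that the upper bound is nonnegative.
    · have := hpt t ht 0 0 (by simp) (by simp)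
      simp only [inner_zero_left, mul_zero, Finset.sum_const_zero] at this
      positivity
    · rw [inner_toEuclideanCLM_outerSum, le_div_iff₀' hl]
      exact hpt t ht a b ha hb
  have hRi' : Integrable (fun t : H × H => R t.1) (μ.prod μ) := hRi.comp_fst μ
  have hZ2 : Integrable (fun t : H × H => (Z t).toReal - 1) (μ.prod μ) :=
    hZi.sub (integrable_const _)
  have hfin := integral_mono_ae ((integrable_norm_outerSum_prod s U V).const_mul l)
    (hZ2.add hRi') hae
  simp only [Pi.add_apply] at hfin
  rw [integral_const_mul, integral_add hZ2 hRi', integral_sub hZi (integrable_const _),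
    integral_fun_fst (f := R), hRint] at hfin
  simp only [integral_const, probReal_univ, smul_eq_mul, one_mul, mul_one] at hfin
  linarith

end GaussianBilinear

/-! ### Decoupling by rotation of an independent pair. -/

section Decoupling

variable {p : ℕ} {α H : Type*} [NormedAddCommGroup H] [NormedSpace ℝ H] [MeasurableSpace H]
  [BorelSpace H] [SecondCountableTopology H]

lemma Matrix.integral_apply_eq {X : Type*} [MeasurableSpace X] {μ : Measure X}
    {f : X → Matrix (Fin p) (Fin p) ℝ} (hf : Integrable f μ) (j k : Fin p) :
    (∫ x, f x ∂μ) j k = ∫ x, f x j k ∂μ :=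
  (ContinuousLinearMap.integral_comp_comm
    (LinearMap.toContinuousLinearMap (Matrix.entryLinearMap ℝ ℝ j k)) hf).symm

/-- The diagonal terms cancel in the difference, and each cross term appears with coefficient `2c² =
1`. -/
lemma outerSum_rotation (s : Finset α) (x y x' y' : α → EuclideanSpace ℝ (Fin p)) {c : ℝ}
    (hc : c ^ 2 = 1 / 2) :
    outerSum s (fun i => c • x i + c • x' i) (fun i => c • y i + c • y' i) -
      outerSum s (fun i => -c • x i + c • x' i) (fun i => -c • y i + c • y' i) =
      outerSum s x y' + outerSum s x' y := by
  ext j k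
  simp only [outerSum, Matrix.sub_apply, Matrix.add_apply, Matrix.sum_apply, Matrix.of_apply,
    ← Finset.sum_sub_distrib, ← Finset.sum_add_distrib]
  refine Finset.sum_congr rfl fun i _ => ?_
  simp only [PiLp.add_apply, PiLp.smul_apply, smul_eq_mul]
  linear_combination (2 * (x i j * y' i k + x' i j * y i k)) * hc

lemma integrable_outerSum {μ : Measure H} [IsGaussian μ] [CompleteSpace H]
    (s : Finset α) (U V : α → H →L[ℝ] EuclideanSpace ℝ (Fin p)) :
    Integrable (fun u : H => outerSum s (fun i => U i u) (fun i => V i u)) μ := by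
  have hc : Continuous fun u : H => outerSum s (fun i => U i u) (fun i => V i u) :=
    continuous_outerSum s (fun i => by fun_prop) (fun i => by fun_prop)
  exact (integrable_norm_iff hc.aestronglyMeasurable).1 (integrable_norm_outerSum s U V)

/-- Decoupling of a quadratic functional of a centered Gaussian vector. -/
theorem integral_norm_outerSum_sub_le {μ : Measure H} [IsGaussian μ] (hμ : ∫ v, id v ∂μ = 0)
    [CompleteSpace H] (s : Finset α) (U V : α → H →L[ℝ] EuclideanSpace ℝ (Fin p))
    {M : Matrix (Fin p) (Fin p) ℝ}
    (hM : ∀ j k, ∫ u, outerSum s (fun i => U i u) (fun i => V i u) j k ∂μ = M j k) :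
    ∫ u, ‖outerSum s (fun i => U i u) (fun i => V i u) - M‖ ∂μ ≤
      2 * ∫ t : H × H, ‖outerSum s (fun i => U i t.1) (fun i => V i t.2)‖ ∂μ.prod μ := by
  set X : H → Matrix (Fin p) (Fin p) ℝ := fun u => outerSum s (fun i => U i u) (fun i => V i u)
    with hX
  have hXc : Continuous X := continuous_outerSum s (fun i => by fun_prop) (fun i => by fun_prop)
  have hXi : Integrable X μ := integrable_outerSum s U V
  have hMX : M = ∫ u, X u ∂μ := by
    ext j k
    rw [Matrix.integral_apply_eq hXi, hM]
  have hD : Integrable (fun t : H × H => ‖X t.1 - X t.2‖) (μ.prod μ) :=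
    ((hXi.comp_fst μ).sub (hXi.comp_snd μ)).norm
  -- Jensen's inequality: `M` is the mean of `X` over an independent copy.
  have h1 : ∀ u, ‖X u - M‖ ≤ ∫ v, ‖X u - X v‖ ∂μ := fun u => by
    have : X u - M = ∫ v, (X u - X v) ∂μ := by
      rw [integral_sub (integrable_const _) hXi, hMX]; simp
    rw [this]
    exact norm_integral_le_integral_norm _
  have h2 : ∫ u, ‖X u - M‖ ∂μ ≤ ∫ t : H × H, ‖X t.1 - X t.2‖ ∂μ.prod μ := by
    rw [integral_prod _ hD]
    exact integral_mono (hXi.sub (integrable_const M)).norm hD.integral_prod_left h1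
  refine h2.trans ?_
  have hY := integrable_norm_outerSum_prod (μ := μ) s U V
  have hY' : Integrable (fun t : H × H => ‖outerSum s (fun i => U i t.2) (fun i => V i t.1)‖)
      (μ.prod μ) := hY.swap
  have hswap : ∫ t : H × H, ‖outerSum s (fun i => U i t.2) (fun i => V i t.1)‖ ∂μ.prod μ =
      ∫ t : H × H, ‖outerSum s (fun i => U i t.1) (fun i => V i t.2)‖ ∂μ.prod μ :=
    integral_prod_swap (fun t : H × H => ‖outerSum s (fun i => U i t.1) (fun i => V i t.2)‖)
  have hc : (Real.cos (Real.pi / 4)) ^ 2 = 1 / 2 := by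
    rw [Real.cos_pi_div_four, div_pow, Real.sq_sqrt (by norm_num)]; norm_num
  -- The law of a pair of independent centred Gaussian copies is invariant under rotation by `π /
  -- 4`, which converts the difference of two quadratic terms into two cross terms of equal expected
  -- norm.
  calc ∫ t : H × H, ‖X t.1 - X t.2‖ ∂μ.prod μ
      = ∫ t : H × H, ‖X t.1 - X t.2‖
          ∂(μ.prod μ).map (ContinuousLinearMap.rotation (Real.pi / 4)) := by
        rw [IsGaussian.map_rotation_eq_self hμ]
    _ = ∫ t : H × H, ‖outerSum s (fun i => U i t.1) (fun i => V i t.2) +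
          outerSum s (fun i => U i t.2) (fun i => V i t.1)‖ ∂μ.prod μ := by
        rw [integral_map (by fun_prop) (by
          exact Continuous.aestronglyMeasurable (by fun_prop))]
        refine integral_congr_ae (Filter.Eventually.of_forall fun t => ?_)
        have hcs : Real.sin (Real.pi / 4) = Real.cos (Real.pi / 4) := by
          rw [Real.sin_pi_div_four, Real.cos_pi_div_four]
        simp only [hX, ContinuousLinearMap.rotation_apply, hcs, map_add, map_smul]
        rw [outerSum_rotation s _ _ _ _ hc]
    _ ≤ ∫ t : H × H, (‖outerSum s (fun i => U i t.1) (fun i => V i t.2)‖ +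
          ‖outerSum s (fun i => U i t.2) (fun i => V i t.1)‖) ∂μ.prod μ := by
        refine integral_mono_of_nonneg (Filter.Eventually.of_forall fun t => norm_nonneg _)
          (hY.add hY') (Filter.Eventually.of_forall fun t => norm_add_le _ _)
    _ = _ := by
        rw [integral_add hY hY', hswap]
        ring

end Decoupling

/-- First bound `η₀`, which occurs on both sides of `h₀`, then insert it in the bound for `η`. In
the choice of `θ`, the cap `1 / (2c)` lets half of `η₀` be absorbed, and `√(r N) / N` balances `θ N`
against `r / θ`. -/
lemma le_of_self_bounding {c r N η₀ η : ℝ} (hc : 0 < c) (hr : 0 < r) (hN : 0 < N)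
    (h₀ : ∀ θ : ℝ, 0 < θ → θ * η₀ ≤ θ ^ 2 * c * (N + η₀) + r)
    (h : ∀ θ : ℝ, 0 < θ → θ * η ≤ θ ^ 2 * c * (N + η₀) + r) :
    η ≤ 2 * ((c + 1) * √(r * N) + 2 * c * r) := by
  set g := √(r * N) with hg
  have hg0 : 0 < g := Real.sqrt_pos.2 (by positivity)
  have hgsq : g ^ 2 = r * N := Real.sq_sqrt (by positivity)
  set θ := min (1 / (2 * c)) (g / N) with hθ
  have hθ0 : 0 < θ := lt_min (by positivity) (by positivity)
  have hθc : θ * c ≤ 1 / 2 := by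
    have : θ ≤ 1 / (2 * c) := min_le_left _ _
    rw [le_div_iff₀ (by positivity)] at this
    linarith
  have hθN : θ * N ≤ g := by
    have : θ ≤ g / N := min_le_right _ _
    rwa [le_div_iff₀ hN] at this
  have hrθ : r ≤ θ * (2 * c * r + g) := by
    rcases min_choice (1 / (2 * c)) (g / N) with h1 | h1 <;> rw [hθ, h1]
    · rw [div_mul_eq_mul_div, le_div_iff₀ (by positivity)]
      nlinarith
    · rw [div_mul_eq_mul_div, le_div_iff₀ hN]
      nlinarith [mul_pos hg0 (mul_pos hc hr)]
  have e₀ : η₀ ≤ θ * c * (N + η₀) + (2 * c * r + g) := by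
    have := h₀ θ hθ0
    refine le_of_mul_le_mul_left ?_ hθ0
    nlinarith
  have e : η ≤ θ * c * (N + η₀) + (2 * c * r + g) := by
    have := h θ hθ0
    refine le_of_mul_le_mul_left ?_ hθ0
    nlinarith
  have hcN : θ * c * N ≤ c * g := by nlinarith
  rcases le_total 0 η₀ with hη | hη
  · have : θ * c * η₀ ≤ 1 / 2 * η₀ := mul_le_mul_of_nonneg_right hθc hη
    nlinarith
  · have : θ * c * η₀ ≤ 0 := mul_nonpos_of_nonneg_of_nonpos (by positivity) hη
    nlinarith [mul_pos hc hr, mul_pos hc hg0]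

/-! ### Deviation bound from a smoothed variance proxy. -/

section Abstract

variable {p : ℕ} {α H : Type*} [NormedAddCommGroup H] [NormedSpace ℝ H] [MeasurableSpace H]
  [BorelSpace H] [SecondCountableTopology H]

/-- Deviation of the sum of outer products of jointly Gaussian vectors from its mean, under
a uniform bound on the Gaussian smoothing of the variance proxy `q`. -/
theorem integral_norm_outerSum_sub_le_of_variance_proxy {μ : Measure H} [IsGaussian μ]
    (hμ : ∫ v, id v ∂μ = 0) [CompleteSpace H] (s : Finset α) (hs : s.Nonempty)
    {q : EuclideanSpace ℝ (Fin p) → ℝ} (hqm : Measurable q) {c r ρ : ℝ} (hc : 0 < c) (hr : 0 < r)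
    (hρ : 0 < ρ) (U V : α → H →L[ℝ] EuclideanSpace ℝ (Fin p))
    (hU : ∀ (c : α → ℝ) (b : EuclideanSpace ℝ (Fin p)),
      ∫ v, (∑ i ∈ s, c i * inner ℝ b (U i v)) ^ 2 ∂μ ≤ (∑ i ∈ s, c i ^ 2) * q b)
    (hV : ∀ (c : α → ℝ) (b : EuclideanSpace ℝ (Fin p)),
      ∫ v, (∑ i ∈ s, c i * inner ℝ b (V i v)) ^ 2 ∂μ ≤ (∑ i ∈ s, c i ^ 2) * q b)
    (hqi : ∀ b (σ : ℝ), Integrable (fun w => q (b + σ • w))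
      (stdGaussian (EuclideanSpace ℝ (Fin p))))
    (hqB : ∀ b (σ : ℝ), ‖b‖ ≤ 1 → 0 < σ → σ ^ 2 = 1 / r →
      ∫ w, q (b + σ • w) ∂stdGaussian (EuclideanSpace ℝ (Fin p)) ≤ c * ρ)
    (hU2 : ∀ i ∈ s, ∫ u, ‖U i u‖ ^ 2 ∂μ = r * ρ)
    {M₀ M : Matrix (Fin p) (Fin p) ℝ} (hM₀ : ‖M₀‖ ≤ s.card * ρ)
    (hMU : ∀ j k, ∫ u, outerSum s (fun i => U i u) (fun i => U i u) j k ∂μ = M₀ j k)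
    (hM : ∀ j k, ∫ u, outerSum s (fun i => U i u) (fun i => V i u) j k ∂μ = M j k) :
    ∫ u, ‖outerSum s (fun i => U i u) (fun i => V i u) - M‖ ∂μ ≤
      4 * ρ * ((c + 1) * √(r * s.card) + 2 * c * r) := by
  set N : ℝ := (s.card : ℝ) with hN
  have hN0 : 0 < N := by simpa [hN] using hs.card_pos
  set σ := √(1 / r) with hσ
  have hσ0 : 0 < σ := Real.sqrt_pos.2 (by positivity)
  have hσ2 : σ ^ 2 = 1 / r := Real.sq_sqrt (by positivity)
  set y₀ := ∫ t : H × H, ‖outerSum s (fun i => U i t.1) (fun i => U i t.2)‖ ∂μ.prod μ with hy₀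
  set y := ∫ t : H × H, ‖outerSum s (fun i => U i t.1) (fun i => V i t.2)‖ ∂μ.prod μ with hy
  -- Decoupling applied with `V = U` closes the loop: the quadratic term is controlled by its mean
  -- and by `y₀` itself.
  have hA : ∫ u, ‖outerSum s (fun i => U i u) (fun i => U i u)‖ ∂μ ≤ N * ρ + 2 * y₀ := by
    have h1 := integral_norm_outerSum_sub_le hμ s U U hMU
    have hXi := integrable_outerSum (μ := μ) s U U
    have h2 : ∫ u, ‖outerSum s (fun i => U i u) (fun i => U i u)‖ ∂μ ≤
        ∫ u, (‖outerSum s (fun i => U i u) (fun i => U i u) - M₀‖ + ‖M₀‖) ∂μ := by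
      refine integral_mono hXi.norm
        ((hXi.sub (integrable_const M₀)).norm.add (integrable_const _)) fun u => ?_
      have := norm_add_le (outerSum s (fun i => U i u) (fun i => U i u) - M₀) M₀
      rwa [sub_add_cancel] at this
    rw [integral_add (f := fun u => ‖outerSum s (fun i => U i u) (fun i => U i u) - M₀‖)
      (hXi.sub (integrable_const M₀)).norm (integrable_const _)] at h2
    simp only [integral_const, probReal_univ, smul_eq_mul, one_mul] at h2
    linarith
  have hbound : ∀ (W : α → H →L[ℝ] EuclideanSpace ℝ (Fin p)),
      (∀ (c : α → ℝ) (b : EuclideanSpace ℝ (Fin p)),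
        ∫ v, (∑ i ∈ s, c i * inner ℝ b (W i v)) ^ 2 ∂μ ≤ (∑ i ∈ s, c i ^ 2) * q b) →
      ∀ θ : ℝ, 0 < θ →
      θ * ((∫ t : H × H, ‖outerSum s (fun i => U i t.1) (fun i => W i t.2)‖ ∂μ.prod μ) / ρ) ≤
        θ ^ 2 * c * (N + y₀ / ρ) + r := by
    intro W hW θ hθ
    -- Taking `l = θ / ρ` makes the inequality scale-free in `ρ`; the entropy cost `1 / σ²` equals
    -- `r`.
    have h := integral_norm_outerSum_prod_le hμ s hqm (l := θ / ρ) (σ := σ) (B := c * ρ)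
      (by positivity) hσ0 (by positivity) U W hW (fun b => hqi b σ)
      fun b hb => hqB b σ hb hσ0 hσ2
    rw [hσ2, Finset.sum_congr rfl hU2, Finset.sum_const, nsmul_eq_mul, one_div_one_div] at h
    have e1 : 1 / r * (N * (r * ρ)) = N * ρ := by field_simp
    rw [e1] at h
    have h3 : (θ / ρ) ^ 2 / 2 * (c * ρ) *
        (∫ u, ‖outerSum s (fun i => U i u) (fun i => U i u)‖ ∂μ + N * ρ) ≤
        (θ / ρ) ^ 2 / 2 * (c * ρ) * (N * ρ + 2 * y₀ + N * ρ) :=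
      mul_le_mul_of_nonneg_left (by linarith) (by positivity)
    have e2 : (θ / ρ) ^ 2 / 2 * (c * ρ) * (N * ρ + 2 * y₀ + N * ρ) =
        θ ^ 2 * c * (N + y₀ / ρ) := by field_simp; ring
    rw [mul_div_assoc', mul_comm θ, mul_div_assoc, mul_comm _ (θ / ρ)]
    linarith
  have hfin := le_of_self_bounding hc hr hN0 (hbound U hU) (hbound V hV)
  rw [div_le_iff₀ hρ] at hfin
  have := integral_norm_outerSum_sub_le hμ s U V hM
  linarith

end Abstract

/-! ### The `ψ₂` norm of a centred Gaussian variable. -/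

section PsiTwo

/-- Multiplying the density of `N(0, v)` by `exp(x² / (4v))` gives `√2` times the density of `N(0,
2v)`. As `√2 ≤ 2`, the value `k = 2√v` is admissible in the `ψ₂` norm. -/
lemma lintegral_exp_sq_gaussianReal {v : NNReal} (hv : v ≠ 0) :
    ∫⁻ x, ENNReal.ofReal (Real.exp (x ^ 2 / (4 * v))) ∂gaussianReal 0 v = ENNReal.ofReal √2 := by
  have hv0 : (0 : ℝ) < v := NNReal.coe_pos.2 (pos_iff_ne_zero.2 hv)
  have h2v : 2 * v ≠ 0 := mul_ne_zero two_ne_zero hv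
  rw [gaussianReal_of_var_ne_zero _ hv,
    lintegral_withDensity_eq_lintegral_mul _ (by fun_prop) (by fun_prop)]
  have e : ∀ x, (gaussianPDF 0 v * fun x => ENNReal.ofReal (Real.exp (x ^ 2 / (4 * v)))) x =
      ENNReal.ofReal √2 * gaussianPDF 0 (2 * v) x := fun x => by
    simp only [Pi.mul_apply, gaussianPDF]
    rw [← ENNReal.ofReal_mul (gaussianPDFReal_nonneg _ _ _),
      ← ENNReal.ofReal_mul (Real.sqrt_nonneg _)]
    congr 1
    simp only [gaussianPDFReal, sub_zero, NNReal.coe_mul, NNReal.coe_ofNat]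
    rw [mul_assoc, ← Real.exp_add, show 2 * Real.pi * (2 * (v : ℝ)) = 2 * (2 * Real.pi * v) by ring,
      Real.sqrt_mul zero_le_two, mul_inv, ← mul_assoc, ← mul_assoc,
      mul_inv_cancel₀ (by positivity), one_mul]
    congr 2
    field_simp
    ring
  simp_rw [e]
  rw [lintegral_const_mul _ (by fun_prop), lintegral_gaussianPDF_eq_one _ h2v, mul_one]

variable {Ω : Type u} [MeasurableSpace Ω] {P : Measure Ω}

lemma psi2Norm_le_of_hasGaussianLaw {X : Ω → ℝ} (hX : HasGaussianLaw X P) (hmean : ∫ ω, X ω ∂P = 0)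
    {ρ : ℝ} (hρ : 0 < ρ) (hvar : ∫ ω, X ω ^ 2 ∂P ≤ ρ) :
    psi2Norm P X ≤ ENNReal.ofReal (2 * √ρ) := by
  have := hX.isProbabilityMeasure
  have hk : 0 < 2 * √ρ := by positivity
  have hV : Var[X; P] = ∫ ω, X ω ^ 2 ∂P := variance_of_integral_eq_zero hX.aemeasurable hmean
  have hmap := hX.map_eq_gaussianReal
  rw [hmean, hV] at hmap
  set v : NNReal := (∫ ω, X ω ^ 2 ∂P).toNNReal with hv
  have hvρ : (v : ℝ) ≤ ρ := by
    rw [hv, Real.coe_toNNReal _ (integral_nonneg fun ω => sq_nonneg _)]; exact hvar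
  have hsq : (2 * √ρ) ^ 2 = 4 * ρ := by rw [mul_pow, Real.sq_sqrt hρ.le]; ring
  refine iInf₂_le (2 * √ρ) ⟨hk, ?_⟩
  have h1 : ∫⁻ ω, ENNReal.ofReal (Real.exp ((|X ω| / (2 * √ρ)) ^ 2)) ∂P ≤ 2 := by
    have e : ∀ ω, (|X ω| / (2 * √ρ)) ^ 2 = X ω ^ 2 / (4 * ρ) := fun ω => by
      rw [div_pow, sq_abs, hsq]
    simp_rw [e]
    rw [← lintegral_map' (μ := P) (g := X)
      (f := fun x => ENNReal.ofReal (Real.exp (x ^ 2 / (4 * ρ)))) (by fun_prop) hX.aemeasurable,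
      hmap]
    -- A direction may be degenerate, in which case the law is a Dirac mass at 0.
    by_cases hv0 : v = 0
    · rw [hv0, gaussianReal_zero_var, lintegral_dirac]
      simp
    · have hv0' : (0 : ℝ) < v := NNReal.coe_pos.2 (pos_iff_ne_zero.2 hv0)
      calc _ ≤ ∫⁻ x, ENNReal.ofReal (Real.exp (x ^ 2 / (4 * v))) ∂gaussianReal 0 v := by
            refine lintegral_mono fun x => ENNReal.ofReal_le_ofReal (Real.exp_le_exp.2 ?_)
            gcongr
        _ = ENNReal.ofReal √2 := lintegral_exp_sq_gaussianReal hv0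
        _ ≤ ENNReal.ofReal 2 := ENNReal.ofReal_le_ofReal
            ((Real.sqrt_le_left zero_le_two).2 (by norm_num))
        _ = 2 := by simp
  have h2 : ∫⁻ ω, ENNReal.ofReal (Real.exp ((|X ω| / (2 * √ρ)) ^ 2) - 1) ∂P + 1 =
      ∫⁻ ω, ENNReal.ofReal (Real.exp ((|X ω| / (2 * √ρ)) ^ 2)) ∂P := by
    have hone : (1 : ℝ≥0∞) = ∫⁻ _, 1 ∂P := by simp
    conv_lhs => rw [hone]
    rw [← lintegral_add_right _ measurable_const]
    refine lintegral_congr fun ω => ?_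
    rw [← ENNReal.ofReal_one, ← ENNReal.ofReal_add
      (sub_nonneg.2 (Real.one_le_exp (by positivity))) zero_le_one, sub_add_cancel]
  rw [← h2, show (2 : ℝ≥0∞) = 1 + 1 by norm_num] at h1
  exact (ENNReal.add_le_add_iff_right ENNReal.one_ne_top).1 h1

end PsiTwo

/-! ### Second moments, smoothing and weighted Cauchy–Schwarz. -/

section SecondMoments

variable {p : ℕ} {X : Type*} [MeasurableSpace X] {ν : Measure X}

lemma MeasureTheory.MemLp.inner_left {W : X → EuclideanSpace ℝ (Fin p)} (hW : MemLp W 2 ν)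
    (b : EuclideanSpace ℝ (Fin p)) : MemLp (fun x => inner ℝ b (W x)) 2 ν :=
  (innerSL ℝ b).comp_memLp' hW

/-- Gaussian smoothing of a second moment form. -/
lemma integral_stdGaussian_secondMoment [SFinite ν] {W : X → EuclideanSpace ℝ (Fin p)}
    (hW : MemLp W 2 ν) (b : EuclideanSpace ℝ (Fin p)) (σ : ℝ) :
    Integrable (fun z => ∫ x, inner ℝ (b + σ • z) (W x) ^ 2 ∂ν)
        (stdGaussian (EuclideanSpace ℝ (Fin p))) ∧
      ∫ z, ∫ x, inner ℝ (b + σ • z) (W x) ^ 2 ∂ν ∂stdGaussian (EuclideanSpace ℝ (Fin p)) =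
        ∫ x, inner ℝ b (W x) ^ 2 ∂ν + σ ^ 2 * ∫ x, ‖W x‖ ^ 2 ∂ν := by
  have hW2 : Integrable (fun x => ‖W x‖ ^ 2) ν := hW.integrable_norm_pow (by norm_num)
  have hz : Integrable (fun z => ‖b + σ • z‖ ^ 2) (stdGaussian (EuclideanSpace ℝ (Fin p))) := by
    have h : MemLp (fun z => b + σ • z) 2 (stdGaussian (EuclideanSpace ℝ (Fin p))) :=
      (memLp_const b).add (IsGaussian.memLp_two_id.const_smul σ)
    exact h.integrable_norm_pow (by norm_num)
  have hi : Integrable (Function.uncurry fun (z : EuclideanSpace ℝ (Fin p)) x =>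
      inner ℝ (b + σ • z) (W x) ^ 2) ((stdGaussian (EuclideanSpace ℝ (Fin p))).prod ν) := by
    refine Integrable.mono' (hz.mul_prod hW2) ?_ (Filter.Eventually.of_forall fun t => ?_)
    · have h1 : AEStronglyMeasurable (fun t : EuclideanSpace ℝ (Fin p) × X => W t.2)
        ((stdGaussian (EuclideanSpace ℝ (Fin p))).prod ν) := hW.1.comp_snd
      have h2 : AEStronglyMeasurable (fun t : EuclideanSpace ℝ (Fin p) × X => b + σ • t.1)
        ((stdGaussian (EuclideanSpace ℝ (Fin p))).prod ν) :=
        Measurable.aestronglyMeasurable (by fun_prop)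
      exact (h2.inner h1).pow 2
    · rw [Function.uncurry, Real.norm_eq_abs, abs_pow, ← mul_pow]
      exact pow_le_pow_left₀ (abs_nonneg _) (abs_real_inner_le_norm _ _) 2
  refine ⟨hi.integral_prod_left, ?_⟩
  rw [integral_integral_swap hi]
  simp_rw [integral_inner_add_smul_sq_stdGaussian]
  rw [integral_add (hW.inner_left b).integrable_sq (hW2.const_mul _), integral_const_mul]

lemma abs_integral_mul_le {f g : X → ℝ} (hf : MemLp f 2 ν) (hg : MemLp g 2 ν) {e : ℝ}
    (he : 0 < e) :
    |∫ x, f x * g x ∂ν| ≤ (e * ∫ x, f x ^ 2 ∂ν + e⁻¹ * ∫ x, g x ^ 2 ∂ν) / 2 := by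
  have h1 := hf.integrable_sq.const_mul e
  have h2 := hg.integrable_sq.const_mul e⁻¹
  rw [← integral_const_mul, ← integral_const_mul, ← integral_add h1 h2, ← integral_div]
  refine (abs_integral_le_integral_abs).trans
    (integral_mono (hf.integrable_mul hg).abs ((h1.add h2).div_const 2) fun x => ?_)
  have hee : e * e⁻¹ = 1 := mul_inv_cancel₀ he.ne'
  have he' : 0 < e⁻¹ := inv_pos.2 he
  simp only
  rw [abs_le]
  constructor
  · have : 0 ≤ e * (f x + e⁻¹ * g x) ^ 2 := by positivity
    have e2 : e * (f x + e⁻¹ * g x) ^ 2 = e * f x ^ 2 + 2 * (e * e⁻¹) * (f x * g x) +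
      (e * e⁻¹) * e⁻¹ * g x ^ 2 := by ring
    rw [e2, hee] at this
    linarith
  · have : 0 ≤ e * (f x - e⁻¹ * g x) ^ 2 := by positivity
    have e2 : e * (f x - e⁻¹ * g x) ^ 2 = e * f x ^ 2 - 2 * (e * e⁻¹) * (f x * g x) +
      (e * e⁻¹) * e⁻¹ * g x ^ 2 := by ring
    rw [e2, hee] at this
    linarith

/-- This is where `ε > 1` matters: then `1 + ε ≥ 2`, and on a probability space the coupling bounds
control second moments. -/
lemma integral_norm_sq_le_of_eLpNorm_le {F : Type*} [NormedAddCommGroup F] [IsProbabilityMeasure ν]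
    {f : X → F} (hf : AEStronglyMeasurable f ν) {ε K : ℝ} (hε : 1 < ε) (hK : 0 ≤ K)
    (h : eLpNorm f (ENNReal.ofReal (1 + ε)) ν ≤ ENNReal.ofReal K) :
    ∫ x, ‖f x‖ ^ 2 ∂ν ≤ K ^ 2 := by
  have h2 : (2 : ℝ≥0∞) ≤ ENNReal.ofReal (1 + ε) := by
    rw [show (2 : ℝ≥0∞) = ENNReal.ofReal 2 by simp]
    exact ENNReal.ofReal_le_ofReal (by linarith)
  have h3 := (eLpNorm_le_eLpNorm_of_exponent_le h2 hf).trans h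
  have hm : MemLp f 2 ν := ⟨hf, h3.trans_lt ENNReal.ofReal_lt_top⟩
  rw [hm.eLpNorm_eq_integral_rpow_norm two_ne_zero ENNReal.ofNat_ne_top,
    ENNReal.ofReal_le_ofReal_iff hK] at h3
  simp only [ENNReal.toReal_ofNat, Real.rpow_two] at h3
  have h0 : 0 ≤ ∫ x, ‖f x‖ ^ 2 ∂ν := integral_nonneg fun x => by positivity
  rw [← one_div, ← Real.sqrt_eq_rpow] at h3
  calc _ = √(∫ x, ‖f x‖ ^ 2 ∂ν) ^ 2 := (Real.sq_sqrt h0).symm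
    _ ≤ K ^ 2 := pow_le_pow_left₀ (Real.sqrt_nonneg _) h3 2

end SecondMoments

/-! ### Autocovariances as bilinear forms, and the bound on `κ₁`. -/

section Autocovariance

variable {p : ℕ} {Ω : Type u} [MeasurableSpace Ω] {P : Measure Ω}
  {Y : ℤ → Ω → EuclideanSpace ℝ (Fin p)}

lemma integral_coord_mul_coord (hst : IsStationaryProcess P Y) (i : ℤ) (k : ℕ) (a b : Fin p) :
    ∫ ω, Y i ω a * Y (i + k) ω b ∂P = autocov P Y k a b := by
  have hg : Measurable fun y : ℤ → EuclideanSpace ℝ (Fin p) => y 1 a * y (1 + k) b := by fun_prop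
  have h := ((hst (i - 1)).comp hg).integral_eq
  simp only [Function.comp_def] at h
  rw [show 1 + (i - 1) = i by ring, show 1 + (k : ℤ) + (i - 1) = i + k by ring] at h
  simpa [autocov] using h

lemma MeasureTheory.MemLp.coord {X : Ω → EuclideanSpace ℝ (Fin p)} (hX : MemLp X 2 P) (a : Fin p) :
    MemLp (fun ω => X ω a) 2 P :=
  (EuclideanSpace.proj a : EuclideanSpace ℝ (Fin p) →L[ℝ] ℝ).comp_memLp' hX

lemma integral_inner_mul_inner (hst : IsStationaryProcess P Y) (hL2 : ∀ t, MemLp (Y t) 2 P)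
    (i : ℤ) (k : ℕ) (u v : EuclideanSpace ℝ (Fin p)) :
    ∫ ω, inner ℝ u (Y i ω) * inner ℝ v (Y (i + k) ω) ∂P =
      inner ℝ u (Matrix.toEuclideanCLM (𝕜 := ℝ) (autocov P Y k) v) := by
  have hint : ∀ a b, Integrable (fun ω => u a * v b * (Y i ω a * Y (i + k) ω b)) P := fun a b =>
    (((hL2 i).coord a).integrable_mul ((hL2 (i + k)).coord b)).const_mul _
  have e : ∀ ω, inner ℝ u (Y i ω) * inner ℝ v (Y (i + k) ω) =
      ∑ a, ∑ b, u a * v b * (Y i ω a * Y (i + k) ω b) := fun ω => by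
    rw [PiLp.inner_apply, PiLp.inner_apply, Finset.sum_mul_sum]
    refine Finset.sum_congr rfl fun a _ => Finset.sum_congr rfl fun b _ => ?_
    simp
    ring
  simp_rw [e]
  rw [integral_finsetSum _ fun a _ => integrable_finsetSum _ fun b _ => hint a b,
    Matrix.inner_toEuclideanCLM]
  simp only [dotProduct, Matrix.mulVec, Finset.mul_sum]
  refine Finset.sum_congr rfl fun a _ => ?_
  rw [integral_finsetSum _ fun b _ => hint a b]
  refine Finset.sum_congr rfl fun b _ => ?_
  rw [integral_const_mul, integral_coord_mul_coord hst]
  ring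

lemma integral_inner_sq (hst : IsStationaryProcess P Y) (hL2 : ∀ t, MemLp (Y t) 2 P) (i : ℤ)
    (v : EuclideanSpace ℝ (Fin p)) :
    ∫ ω, inner ℝ v (Y i ω) ^ 2 ∂P =
      inner ℝ v (Matrix.toEuclideanCLM (𝕜 := ℝ) (autocov P Y 0) v) := by
  have := integral_inner_mul_inner hst hL2 i 0 v v
  simpa [pow_two] using this

lemma integral_inner_sq_le (hst : IsStationaryProcess P Y) (hL2 : ∀ t, MemLp (Y t) 2 P) (i : ℤ)
    (v : EuclideanSpace ℝ (Fin p)) :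
    ∫ ω, inner ℝ v (Y i ω) ^ 2 ∂P ≤ ‖autocov P Y 0‖ * ‖v‖ ^ 2 := by
  rw [integral_inner_sq hst hL2]
  have := (le_abs_self _).trans (inner_toEuclideanCLM_le (autocov P Y 0) v v)
  rwa [mul_assoc, ← pow_two] at this

lemma integral_norm_sq (hst : IsStationaryProcess P Y) (hL2 : ∀ t, MemLp (Y t) 2 P) (i : ℤ) :
    ∫ ω, ‖Y i ω‖ ^ 2 ∂P = (autocov P Y 0).trace := by
  simp_rw [EuclideanSpace.real_norm_sq_eq]
  rw [integral_finsetSum _ fun a _ => ((hL2 i).coord a).integrable_sq, Matrix.trace]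
  refine Finset.sum_congr rfl fun a _ => ?_
  have := integral_coord_mul_coord hst i 0 a a
  simpa [pow_two] using this

lemma kappaOne_le (hG : IsGaussianProcess Y P) (hmean : ∀ t, ∫ ω, Y t ω ∂P = 0)
    (hst : IsStationaryProcess P Y) (hρ : 0 < ‖autocov P Y 0‖) :
    kappaOne P Y ≤ ENNReal.ofReal (2 * √‖autocov P Y 0‖) := by
  have hL2 : ∀ t, MemLp (Y t) 2 P := fun t => (hG.hasGaussianLaw_eval t).memLp_two
  refine iSup_le fun t => iSup₂_le fun v hv => ?_
  refine psi2Norm_le_of_hasGaussianLaw ((hG.hasGaussianLaw_eval t).map_fun (innerSL ℝ v)) ?_ hρ ?_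
  · have := (innerSL ℝ v).integral_comp_comm (hG.hasGaussianLaw_eval t).integrable
    rw [hmean, map_zero] at this
    exact this
  · have := integral_inner_sq_le hst hL2 t v
    rwa [mem_sphere_zero_iff_norm.1 hv, one_pow, mul_one] at this

end Autocovariance

/-! ### Covariances through a decoupled future. -/

section Coupling

variable {p : ℕ} {Ω Ω' : Type u} [MeasurableSpace Ω] [MeasurableSpace Ω'] {P : Measure Ω}
  {Y : ℤ → Ω → EuclideanSpace ℝ (Fin p)} {j : ℤ} {P' : Measure Ω'} {π : Ω' → Ω}
  {Z : Set.Ioi j → Ω' → EuclideanSpace ℝ (Fin p)}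

namespace IsDecoupledFuture

lemma isProbabilityMeasure [IsProbabilityMeasure P] (h : IsDecoupledFuture P Y j P' π Z) :
    IsProbabilityMeasure P' :=
  ⟨by rw [← Set.preimage_univ (f := π), h.extension.measure_preimage nullMeasurableSet_univ,
    measure_univ]⟩

lemma identDistrib_eval (h : IsDecoupledFuture P Y j P' π Z) (k : Set.Ioi j) :
    IdentDistrib (Z k) (Y k) P' P :=
  h.identDistrib.comp (u := fun y : Set.Ioi j → EuclideanSpace ℝ (Fin p) => y k)
    (measurable_pi_apply k)

lemma memLp_left (h : IsDecoupledFuture P Y j P' π Z) (hL2 : ∀ t, MemLp (Y t) 2 P) (t : ℤ) :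
    MemLp (fun ω => Y t (π ω)) 2 P' :=
  (hL2 t).comp_measurePreserving h.extension

lemma memLp_sub (h : IsDecoupledFuture P Y j P' π Z) (hL2 : ∀ t, MemLp (Y t) 2 P)
    (k : Set.Ioi j) : MemLp (fun ω => Y k (π ω) - Z k ω) 2 P' :=
  (h.memLp_left hL2 k).sub ((h.identDistrib_eval k).memLp_iff.2 (hL2 k))

/-- The copy `Z k` is centred and independent of `Y j`, so subtracting it from `Y k` does not change
the covariance with `Y j`. -/
lemma integral_inner_mul_inner_sub [IsProbabilityMeasure P] (h : IsDecoupledFuture P Y j P' π Z)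
    (hL2 : ∀ t, MemLp (Y t) 2 P) (hmean : ∀ t, ∫ ω, Y t ω ∂P = 0) (k : Set.Ioi j)
    (u v : EuclideanSpace ℝ (Fin p)) :
    ∫ ω, inner ℝ u (Y j (π ω)) * inner ℝ v (Y k (π ω) - Z k ω) ∂P' =
      ∫ ω, inner ℝ u (Y j ω) * inner ℝ v (Y k ω) ∂P := by
  have hZ := (h.identDistrib_eval k).memLp_iff.2 (hL2 k)
  have hind : IndepFun (fun ω => inner ℝ u (Y j (π ω))) (fun ω => inner ℝ v (Z k ω)) P' :=
    (h.indep.comp (φ := fun z : Set.Ioi j → EuclideanSpace ℝ (Fin p) => inner ℝ v (z k))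
      (ψ := fun y : Set.Iic j → EuclideanSpace ℝ (Fin p) => inner ℝ u (y ⟨j, Set.mem_Iic.2 le_rfl⟩))
      (by fun_prop) (by fun_prop)).symm
  have hZ0 : ∫ ω, inner ℝ v (Z k ω) ∂P' = 0 := by
    have := isProbabilityMeasure h
    have h1 := (innerSL ℝ v).integral_comp_comm (hZ.integrable one_le_two)
    rw [(h.identDistrib_eval k).integral_eq, hmean, map_zero] at h1
    exact h1
  have hzero : ∫ ω, inner ℝ u (Y j (π ω)) * inner ℝ v (Z k ω) ∂P' = 0 := by
    rw [hind.integral_fun_mul_eq_mul_integral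
      ((h.memLp_left hL2 j).inner_left u).1 (hZ.inner_left v).1, hZ0, mul_zero]
  have i1 : Integrable (fun ω => inner ℝ u (Y j (π ω)) * inner ℝ v (Y k (π ω))) P' :=
    ((h.memLp_left hL2 j).inner_left u).integrable_mul ((h.memLp_left hL2 k).inner_left v)
  have i2 : Integrable (fun ω => inner ℝ u (Y j (π ω)) * inner ℝ v (Z k ω)) P' :=
    ((h.memLp_left hL2 j).inner_left u).integrable_mul (hZ.inner_left v)
  simp_rw [inner_sub_right, mul_sub]
  rw [integral_sub i1 i2, hzero, sub_zero]
  have hmeas : AEStronglyMeasurable (fun ω => inner ℝ u (Y j ω) * inner ℝ v (Y k ω)) P :=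
    (((hL2 j).inner_left u).integrable_mul ((hL2 k).inner_left v)).1
  rw [← h.extension.map_eq] at hmeas ⊢
  exact (integral_map h.extension.aemeasurable hmeas).symm

end IsDecoupledFuture

end Coupling

/-! ### Small remainders carrying the lag-`k` covariance. -/

section Smoothing

variable {p : ℕ} {Ω : Type u} [MeasurableSpace Ω] {P : Measure Ω} [IsProbabilityMeasure P]
  {Y : ℤ → Ω → EuclideanSpace ℝ (Fin p)} {γ γ' ε κ : ℝ}

/-- The remainder is `W = Y_{1+k} - Z_{1+k}` for the coupling at `j = 1`: it has the same covariance
with `Y₁` as `Y_{1+k}`, but an exponentially small second moment. The lag `k` gives exponent `k -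
1`. -/
lemma NormCoupling.exists_remainder (hc : NormCoupling P Y γ γ' ε) (hε : 1 < ε) (hγ : 0 ≤ γ)
    (hκ0 : 0 ≤ κ) (hκ : kappaOne P Y ≤ ENNReal.ofReal κ) (hL2 : ∀ t, MemLp (Y t) 2 P)
    (hmean : ∀ t, ∫ ω, Y t ω ∂P = 0) {k : ℕ} (hk : 1 ≤ k) :
    ∃ (Ω' : Type u) (_ : MeasurableSpace Ω') (P' : Measure Ω') (_ : IsProbabilityMeasure P')
      (π : Ω' → Ω) (W : Ω' → EuclideanSpace ℝ (Fin p)), MeasurePreserving π P' P ∧ MemLp W 2 P' ∧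
      (∀ u v, ∫ ω, inner ℝ u (Y 1 (π ω)) * inner ℝ v (W ω) ∂P' =
        ∫ ω, inner ℝ u (Y 1 ω) * inner ℝ v (Y (1 + k) ω) ∂P) ∧
      ∫ ω, ‖W ω‖ ^ 2 ∂P' ≤ (γ * κ * Real.exp (-γ' * ((k : ℝ) - 1))) ^ 2 := by
  obtain ⟨Ω', _, P', π, Z, hd, hb⟩ := hc 1
  have := hd.isProbabilityMeasure
  set k' : Set.Ioi (1 : ℤ) := ⟨1 + k, by simp only [Set.mem_Ioi]; omega⟩ with hk'
  refine ⟨Ω', _, P', this, π, fun ω => Y k' (π ω) - Z k' ω, hd.extension, hd.memLp_sub hL2 k',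
    hd.integral_inner_mul_inner_sub hL2 hmean k', ?_⟩
  have h1 := hb k'
  have h2 : eLpNorm (fun ω => ‖Y k' (π ω) - Z k' ω‖) (ENNReal.ofReal (1 + ε)) P' ≤
      ENNReal.ofReal (γ * κ * Real.exp (-γ' * ((k : ℝ) - 1))) := by
    refine h1.trans ?_
    rw [ENNReal.ofReal_mul (by positivity), ENNReal.ofReal_mul hγ]
    have e : -γ' * (((k' : ℤ) : ℝ) - ((1 : ℤ) : ℝ) - 1) = -γ' * ((k : ℝ) - 1) := by
      simp [hk']
    rw [e]
    gcongr
  have h3 := integral_norm_sq_le_of_eLpNorm_le (hd.memLp_sub hL2 k').1.norm hε (by positivity) h2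
  simpa only [norm_norm] using h3

lemma DirectionalCoupling.exists_remainder (hc : DirectionalCoupling P Y γ γ' ε) (hε : 1 < ε)
    (hγ : 0 ≤ γ) (hκ0 : 0 ≤ κ) (hκ : kappaOne P Y ≤ ENNReal.ofReal κ)
    (hL2 : ∀ t, MemLp (Y t) 2 P) (hmean : ∀ t, ∫ ω, Y t ω ∂P = 0) {k : ℕ} (hk : 1 ≤ k) :
    ∃ (Ω' : Type u) (_ : MeasurableSpace Ω') (P' : Measure Ω') (_ : IsProbabilityMeasure P')
      (π : Ω' → Ω) (W : Ω' → EuclideanSpace ℝ (Fin p)), MeasurePreserving π P' P ∧ MemLp W 2 P' ∧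
      (∀ u v, ∫ ω, inner ℝ u (Y 1 (π ω)) * inner ℝ v (W ω) ∂P' =
        ∫ ω, inner ℝ u (Y 1 ω) * inner ℝ v (Y (1 + k) ω) ∂P) ∧
      ∀ b, ‖b‖ ≤ 1 → ∫ ω, inner ℝ b (W ω) ^ 2 ∂P' ≤
        (γ * κ * Real.exp (-γ' * ((k : ℝ) - 1))) ^ 2 := by
  obtain ⟨Ω', _, P', π, Z, hd, hb⟩ := hc 1
  have := hd.isProbabilityMeasure
  set k' : Set.Ioi (1 : ℤ) := ⟨1 + k, by simp only [Set.mem_Ioi]; omega⟩ with hk'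
  have hW := hd.memLp_sub hL2 k'
  refine ⟨Ω', _, P', this, π, fun ω => Y k' (π ω) - Z k' ω, hd.extension, hW,
    hd.integral_inner_mul_inner_sub hL2 hmean k', fun b hb1 => ?_⟩
  -- The coupling condition speaks of unit vectors only; other `b` are normalised, which excludes `b
  -- = 0`.
  rcases eq_or_ne b 0 with rfl | hb0
  · simp only [inner_zero_left]
    simp only [ne_eq, OfNat.ofNat_ne_zero, not_false_eq_true, zero_pow, integral_zero]
    positivity
  have hn : ‖b‖ ≠ 0 := norm_ne_zero_iff.2 hb0
  set v := ‖b‖⁻¹ • b with hv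
  have hv1 : v ∈ Metric.sphere (0 : EuclideanSpace ℝ (Fin p)) 1 := by
    rw [mem_sphere_zero_iff_norm, hv, norm_smul, norm_inv, norm_norm, inv_mul_cancel₀ hn]
  have hbv : b = ‖b‖ • v := by rw [hv, smul_smul, mul_inv_cancel₀ hn, one_smul]
  have h1 := (le_iSup₂ (f := fun (v : EuclideanSpace ℝ (Fin p))
    (_ : v ∈ Metric.sphere (0 : EuclideanSpace ℝ (Fin p)) 1) =>
    eLpNorm (fun ω => inner ℝ (Y k' (π ω) - Z k' ω) v) (ENNReal.ofReal (1 + ε)) P') v hv1).trans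
    (hb k')
  have h2 : eLpNorm (fun ω => inner ℝ v (Y k' (π ω) - Z k' ω)) (ENNReal.ofReal (1 + ε)) P' ≤
      ENNReal.ofReal (γ * κ * Real.exp (-γ' * ((k : ℝ) - 1))) := by
    simp_rw [real_inner_comm v] at h1
    refine h1.trans ?_
    rw [ENNReal.ofReal_mul (by positivity), ENNReal.ofReal_mul hγ]
    have e : -γ' * (((k' : ℤ) : ℝ) - ((1 : ℤ) : ℝ) - 1) = -γ' * ((k : ℝ) - 1) := by
      simp [hk']
    rw [e]
    gcongr
  have h3 := integral_norm_sq_le_of_eLpNorm_le (hW.inner_left v).1 hε (by positivity) h2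
  simp only [Real.norm_eq_abs, sq_abs] at h3
  refine le_trans ?_ h3
  have e : ∀ ω, inner ℝ b (Y k' (π ω) - Z k' ω) ^ 2 =
      ‖b‖ ^ 2 * inner ℝ v (Y k' (π ω) - Z k' ω) ^ 2 := fun ω => by
    rw [← mul_pow, ← real_inner_smul_left, ← hbv]
  simp_rw [e]
  rw [integral_const_mul]
  exact mul_le_of_le_one_left (integral_nonneg fun ω => sq_nonneg _)
    (pow_le_one₀ (norm_nonneg _) hb1)

end Smoothing

/-! ### The variance proxy of a stationary sequence and its smoothing. -/

section VarianceProxy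

variable {p : ℕ} {Ω : Type u} [MeasurableSpace Ω] {P : Measure Ω}
  {Y : ℤ → Ω → EuclideanSpace ℝ (Fin p)}

lemma integrable_abs_quadraticForm (A : Matrix (Fin p) (Fin p) ℝ) (b : EuclideanSpace ℝ (Fin p))
    (σ : ℝ) :
    Integrable (fun z => |inner ℝ (b + σ • z) (Matrix.toEuclideanCLM (𝕜 := ℝ) A (b + σ • z))|)
      (stdGaussian (EuclideanSpace ℝ (Fin p))) := by
  have h : MemLp (fun z => b + σ • z) 2 (stdGaussian (EuclideanSpace ℝ (Fin p))) :=
    (memLp_const b).add (IsGaussian.memLp_two_id.const_smul σ)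
  refine Integrable.mono' ((h.integrable_norm_pow (by norm_num)).const_mul ‖A‖)
    (Continuous.aestronglyMeasurable (by fun_prop)) (Filter.Eventually.of_forall fun z => ?_)
  rw [Real.norm_eq_abs, abs_abs, pow_two, ← mul_assoc]
  exact inner_toEuclideanCLM_le A _ _

/-- Upper bound for the variance of `∑ cᵢ ⟨v, Yᵢ⟩` over coefficients with `∑ cᵢ² = 1`. -/
noncomputable def varianceProxy (P : Measure Ω) (Y : ℤ → Ω → EuclideanSpace ℝ (Fin p)) (n : ℕ)
    (v : EuclideanSpace ℝ (Fin p)) : ℝ :=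
  |inner ℝ v (Matrix.toEuclideanCLM (𝕜 := ℝ) (autocov P Y 0) v)| +
    2 * ∑ k ∈ Finset.Icc 1 n, |inner ℝ v (Matrix.toEuclideanCLM (𝕜 := ℝ) (autocov P Y k) v)|

lemma measurable_varianceProxy (n : ℕ) : Measurable (varianceProxy P Y n) := by
  unfold varianceProxy
  exact Continuous.measurable (by fun_prop)

lemma integrable_varianceProxy (n : ℕ) (b : EuclideanSpace ℝ (Fin p)) (σ : ℝ) :
    Integrable (fun z => varianceProxy P Y n (b + σ • z))
      (stdGaussian (EuclideanSpace ℝ (Fin p))) :=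
  (integrable_abs_quadraticForm _ b σ).add
    ((integrable_finsetSum _ fun _ _ => integrable_abs_quadraticForm _ b σ).const_mul 2)

/-- With truncated subtraction `(i - j) + (j - i)` is `|i - j|`. Lag 0 occurs once, and every other
lag at most once on each side of `i`. -/
lemma sum_dist_le (f : ℕ → ℝ) (hf : ∀ k, 0 ≤ f k) (N i : ℕ) (hi : i ∈ Finset.Icc 1 N) :
    ∑ j ∈ Finset.Icc 1 N, f ((i - j) + (j - i)) ≤ f 0 + 2 * ∑ k ∈ Finset.Icc 1 N, f k := by
  rw [Finset.mem_Icc] at hi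
  have hlt : ∑ j ∈ (Finset.Icc 1 N).filter (· < i), f ((i - j) + (j - i)) ≤
      ∑ k ∈ Finset.Icc 1 N, f k := by
    rw [← Finset.sum_image (f := f) (g := fun j => (i - j) + (j - i))]
    · refine Finset.sum_le_sum_of_subset_of_nonneg (fun k hk => ?_) fun k _ _ => hf k
      simp only [Finset.mem_image, Finset.mem_filter, Finset.mem_Icc] at hk ⊢
      obtain ⟨j, hj, rfl⟩ := hk
      omega
    · intro a ha b hb hab
      simp only [Finset.coe_filter, Finset.mem_Icc, Set.mem_ofPred_eq] at ha hb
      simp only at hab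
      omega
  have hgt : ∑ j ∈ ((Finset.Icc 1 N).filter (¬ · < i)).filter (i < ·), f ((i - j) + (j - i)) ≤
      ∑ k ∈ Finset.Icc 1 N, f k := by
    rw [← Finset.sum_image (f := f) (g := fun j => (i - j) + (j - i))]
    · refine Finset.sum_le_sum_of_subset_of_nonneg (fun k hk => ?_) fun k _ _ => hf k
      simp only [Finset.mem_image, Finset.mem_filter, Finset.mem_Icc] at hk ⊢
      obtain ⟨j, hj, rfl⟩ := hk
      omega
    · intro a ha b hb hab
      simp only [Finset.coe_filter, Finset.mem_filter, Finset.mem_Icc, Set.mem_ofPred_eq] at ha hb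
      simp only at hab
      omega
  have heq : ((Finset.Icc 1 N).filter (¬ · < i)).filter (¬ i < ·) = {i} := by
    ext j
    simp only [Finset.mem_filter, Finset.mem_Icc, Finset.mem_singleton]
    omega
  rw [← Finset.sum_filter_add_sum_filter_not (Finset.Icc 1 N) (· < i),
    ← Finset.sum_filter_add_sum_filter_not ((Finset.Icc 1 N).filter (¬ · < i)) (i < ·), heq,
    Finset.sum_singleton, Nat.sub_self, add_zero]
  linarith

lemma abs_integral_inner_mul_inner (hst : IsStationaryProcess P Y) (hL2 : ∀ t, MemLp (Y t) 2 P)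
    (v : EuclideanSpace ℝ (Fin p)) (i j : ℕ) (d : ℤ) :
    |∫ ω, inner ℝ v (Y (i + d) ω) * inner ℝ v (Y (j + d) ω) ∂P| =
      |inner ℝ v (Matrix.toEuclideanCLM (𝕜 := ℝ) (autocov P Y ((i - j) + (j - i))) v)| := by
  rcases le_total i j with h | h
  · rw [← integral_inner_mul_inner hst hL2 (i + d)]
    have e : ((i : ℤ) + d) + ((i - j + (j - i) : ℕ) : ℤ) = j + d := by omega
    rw [e]
  · rw [← integral_inner_mul_inner hst hL2 (j + d)]
    have e : ((j : ℤ) + d) + ((i - j + (j - i) : ℕ) : ℤ) = i + d := by omega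
    rw [e]
    simp_rw [mul_comm (inner ℝ v (Y (i + d) _))]

/-- Schur's test: `|cᵢ cⱼ| ≤ (cᵢ² + cⱼ²) / 2`, and every row of absolute covariances sums to at most
`varianceProxy`. -/
lemma integral_sq_sum_le_varianceProxy (hst : IsStationaryProcess P Y)
    (hL2 : ∀ t, MemLp (Y t) 2 P) (N : ℕ) (d : ℤ) (c : ℕ → ℝ) (v : EuclideanSpace ℝ (Fin p)) :
    ∫ ω, (∑ i ∈ Finset.Icc 1 N, c i * inner ℝ v (Y (i + d) ω)) ^ 2 ∂P ≤
      (∑ i ∈ Finset.Icc 1 N, c i ^ 2) * varianceProxy P Y N v := by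
  set f : ℕ → ℝ := fun k =>
    |inner ℝ v (Matrix.toEuclideanCLM (𝕜 := ℝ) (autocov P Y k) v)| with hf
  have hint : ∀ i j : ℕ, Integrable (fun ω => c i * c j *
      (inner ℝ v (Y (i + d) ω) * inner ℝ v (Y (j + d) ω))) P := fun i j =>
    (((hL2 _).inner_left v).integrable_mul ((hL2 _).inner_left v)).const_mul _
  have e : ∀ ω, (∑ i ∈ Finset.Icc 1 N, c i * inner ℝ v (Y (i + d) ω)) ^ 2 =
      ∑ i ∈ Finset.Icc 1 N, ∑ j ∈ Finset.Icc 1 N,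
        c i * c j * (inner ℝ v (Y (i + d) ω) * inner ℝ v (Y (j + d) ω)) := fun ω => by
    rw [pow_two, Finset.sum_mul_sum]
    exact Finset.sum_congr rfl fun i _ => Finset.sum_congr rfl fun j _ => by ring
  simp_rw [e]
  rw [integral_finsetSum _ fun i _ => integrable_finsetSum _ fun j _ => hint i j]
  have e2 : ∀ i ∈ Finset.Icc 1 N, ∫ ω, ∑ j ∈ Finset.Icc 1 N,
      c i * c j * (inner ℝ v (Y (i + d) ω) * inner ℝ v (Y (j + d) ω)) ∂P ≤
      ∑ j ∈ Finset.Icc 1 N, (c i ^ 2 / 2 * f ((i - j) + (j - i)) +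
        c j ^ 2 / 2 * f ((j - i) + (i - j))) := fun i _ => by
    rw [integral_finsetSum _ fun j _ => hint i j]
    refine Finset.sum_le_sum fun j _ => ?_
    rw [integral_const_mul, add_comm (j - i)]
    refine (le_abs_self _).trans ?_
    rw [abs_mul, abs_integral_inner_mul_inner hst hL2, ← add_mul]
    refine mul_le_mul_of_nonneg_right ?_ (abs_nonneg _)
    rw [abs_le]
    constructor <;> nlinarith [sq_nonneg (c i + c j), sq_nonneg (c i - c j)]
  refine (Finset.sum_le_sum e2).trans ?_
  simp_rw [Finset.sum_add_distrib]
  rw [Finset.sum_comm (f := fun i j => c j ^ 2 / 2 * f ((j - i) + (i - j)))]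
  simp_rw [← Finset.mul_sum]
  rw [← Finset.sum_add_distrib, Finset.sum_mul]
  refine Finset.sum_le_sum fun i hi => ?_
  have := mul_le_mul_of_nonneg_left (sum_dist_le f (fun k => abs_nonneg _) N i hi)
    (sq_nonneg (c i))
  change _ ≤ c i ^ 2 * (f 0 + 2 * ∑ k ∈ Finset.Icc 1 N, f k)
  linarith

variable [IsProbabilityMeasure P] {γ₁ γ₂ γ₃ γ₄ ε : ℝ}

/-- With `w = b + σ z`, only the second argument of `wᵀ Σₖ w` is split. The part along `b` uses the
directional remainder, whose bound is free of `r`; the part along `σ z` uses the norm remainder,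
whose squared size may grow like `r` but is multiplied by `σ² = 1 / r`. -/
lemma integral_abs_quadraticForm_autocov_le (hst : IsStationaryProcess P Y)
    (hL2 : ∀ t, MemLp (Y t) 2 P) (hmean : ∀ t, ∫ ω, Y t ω ∂P = 0) {r ρ K₁ K₃ : ℝ} (hr : 0 < r)
    (hρ : 0 < ρ) (hnorm : ‖autocov P Y 0‖ = ρ) (htr : (autocov P Y 0).trace = r * ρ)
    (hκ : kappaOne P Y ≤ ENNReal.ofReal (2 * √ρ)) (hε : 1 < ε) (hγ₁ : 0 ≤ γ₁) (hγ₃ : 0 ≤ γ₃)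
    (h1 : NormCoupling P Y γ₁ γ₂ ε) (h3 : DirectionalCoupling P Y γ₃ γ₄ ε)
    (hK₁ : γ₁ ≤ K₁ * √r) (hK₃ : γ₃ ≤ K₃) {k : ℕ} (hk : 1 ≤ k) (b : EuclideanSpace ℝ (Fin p))
    (hb : ‖b‖ ≤ 1) {σ : ℝ} (hσ : σ ^ 2 = 1 / r) :
    ∫ z, |inner ℝ (b + σ • z) (Matrix.toEuclideanCLM (𝕜 := ℝ) (autocov P Y k) (b + σ • z))|
        ∂stdGaussian (EuclideanSpace ℝ (Fin p)) ≤
      ρ * ((1 + 2 * K₃ ^ 2) * Real.exp (-γ₄ * ((k : ℝ) - 1)) +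
        (1 + 2 * K₁ ^ 2) * Real.exp (-γ₂ * ((k : ℝ) - 1))) := by
  obtain ⟨Ω₁, _, P₁, _, π₁, W₁, hπ₁, hW₁, hcov₁, hb₁⟩ :=
    h1.exists_remainder hε hγ₁ (by positivity) hκ hL2 hmean hk
  obtain ⟨Ω₃, _, P₃, _, π₃, W₃, hπ₃, hW₃, hcov₃, hb₃⟩ :=
    h3.exists_remainder hε hγ₃ (by positivity) hκ hL2 hmean hk
  set e₂ := Real.exp (-γ₂ * ((k : ℝ) - 1)) with he₂
  set e₄ := Real.exp (-γ₄ * ((k : ℝ) - 1)) with he₄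
  have he₂0 : 0 < e₂ := Real.exp_pos _
  have he₄0 : 0 < e₄ := Real.exp_pos _
  have hcomp : ∀ {Ω' : Type u} [MeasurableSpace Ω'] {P' : Measure Ω'} {π : Ω' → Ω},
      MeasurePreserving π P' P → ∀ w : EuclideanSpace ℝ (Fin p),
      MemLp (fun ω => inner ℝ w (Y 1 (π ω))) 2 P' ∧
        ∫ ω, inner ℝ w (Y 1 (π ω)) ^ 2 ∂P' = ∫ ω, inner ℝ w (Y 1 ω) ^ 2 ∂P := by
    intro Ω' _ P' π hπ w
    refine ⟨((hL2 1).inner_left w).comp_measurePreserving hπ, ?_⟩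
    have hm := ((hL2 1).inner_left w).integrable_sq.1
    rw [← hπ.map_eq] at hm ⊢
    exact (integral_map hπ.aemeasurable hm).symm
  obtain ⟨iV, intV⟩ := integral_stdGaussian_secondMoment (hL2 1) b σ
  obtain ⟨iW, intW⟩ := integral_stdGaussian_secondMoment hW₁ 0 σ
  have hpt : ∀ z, |inner ℝ (b + σ • z)
      (Matrix.toEuclideanCLM (𝕜 := ℝ) (autocov P Y k) (b + σ • z))| ≤
      (e₄ + e₂) / 2 * ∫ ω, inner ℝ (b + σ • z) (Y 1 ω) ^ 2 ∂P +
        e₄⁻¹ / 2 * (γ₃ * (2 * √ρ) * e₄) ^ 2 +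
        e₂⁻¹ / 2 * ∫ ω, inner ℝ (0 + σ • z) (W₁ ω) ^ 2 ∂P₁ := by
    intro z
    set w := b + σ • z with hw
    have hlin : inner ℝ w (Matrix.toEuclideanCLM (𝕜 := ℝ) (autocov P Y k) w) =
        ∫ ω, inner ℝ w (Y 1 (π₃ ω)) * inner ℝ b (W₃ ω) ∂P₃ +
          ∫ ω, inner ℝ w (Y 1 (π₁ ω)) * inner ℝ (0 + σ • z) (W₁ ω) ∂P₁ := by
      rw [hcov₃, hcov₁, integral_inner_mul_inner hst hL2, integral_inner_mul_inner hst hL2,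
        ← inner_add_right, ← map_add, zero_add]
    rw [hlin]
    -- The weights are the decay factors themselves. A remainder has second moment of order `e²`, so
    -- dividing by the weight `e` leaves `e`, matching the factor `e` put on the `Y₁` term.
    have a3 := abs_integral_mul_le (hcomp hπ₃ w).1 (hW₃.inner_left b) he₄0
    have a1 := abs_integral_mul_le (hcomp hπ₁ w).1 (hW₁.inner_left (0 + σ • z)) he₂0
    rw [(hcomp hπ₃ w).2] at a3
    rw [(hcomp hπ₁ w).2] at a1
    have a5 := mul_le_mul_of_nonneg_left (hb₃ b hb) (inv_pos.2 he₄0).le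
    have a6 := abs_add_le (∫ ω, inner ℝ w (Y 1 (π₃ ω)) * inner ℝ b (W₃ ω) ∂P₃)
      (∫ ω, inner ℝ w (Y 1 (π₁ ω)) * inner ℝ (0 + σ • z) (W₁ ω) ∂P₁)
    linarith
  have hsq : √ρ ^ 2 = ρ := Real.sq_sqrt hρ.le
  have hr2 : √r ^ 2 = r := Real.sq_sqrt hr.le
  have iVc := iV.const_mul ((e₄ + e₂) / 2)
  have iWc := iW.const_mul (e₂⁻¹ / 2)
  have iVcc : Integrable (fun z => (e₄ + e₂) / 2 * ∫ ω, inner ℝ (b + σ • z) (Y 1 ω) ^ 2 ∂P +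
      e₄⁻¹ / 2 * (γ₃ * (2 * √ρ) * e₄) ^ 2) (stdGaussian (EuclideanSpace ℝ (Fin p))) :=
    iVc.add (integrable_const _)
  refine (integral_mono (integrable_abs_quadraticForm _ b σ) (iVcc.add iWc) hpt).trans ?_
  simp only [Pi.add_apply]
  rw [integral_add iVcc iWc, integral_add iVc (integrable_const _),
    integral_const_mul ((e₄ + e₂) / 2), integral_const_mul (e₂⁻¹ / 2), intV, intW,
    integral_norm_sq hst hL2, htr, hσ]
  simp only [integral_const, probReal_univ, smul_eq_mul, one_mul, inner_zero_left, ne_eq,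
    OfNat.ofNat_ne_zero, not_false_eq_true, zero_pow, mul_zero, zero_add]
  have hV : ∫ ω, inner ℝ b (Y 1 ω) ^ 2 ∂P ≤ ρ := by
    refine (integral_inner_sq_le hst hL2 1 b).trans ?_
    rw [hnorm]
    exact mul_le_of_le_one_right hρ.le (pow_le_one₀ (norm_nonneg _) hb)
  have t1 : (e₄ + e₂) / 2 * (∫ ω, inner ℝ b (Y 1 ω) ^ 2 ∂P + 1 / r * (r * ρ)) ≤
      (e₄ + e₂) * ρ := by
    have : 1 / r * (r * ρ) = ρ := by field_simp
    rw [this]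
    have := mul_le_mul_of_nonneg_left hV (by positivity : 0 ≤ (e₄ + e₂) / 2)
    linarith
  have t2 : e₄⁻¹ / 2 * (γ₃ * (2 * √ρ) * e₄) ^ 2 ≤ 2 * K₃ ^ 2 * ρ * e₄ := by
    have : e₄⁻¹ / 2 * (γ₃ * (2 * √ρ) * e₄) ^ 2 = 2 * γ₃ ^ 2 * √ρ ^ 2 * e₄ := by
      field_simp
    rw [this, hsq]
    gcongr
  have t3 : e₂⁻¹ / 2 * (1 / r * ∫ ω, ‖W₁ ω‖ ^ 2 ∂P₁) ≤ 2 * K₁ ^ 2 * ρ * e₂ := by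
    calc e₂⁻¹ / 2 * (1 / r * ∫ ω, ‖W₁ ω‖ ^ 2 ∂P₁)
        ≤ e₂⁻¹ / 2 * (1 / r * (γ₁ * (2 * √ρ) * e₂) ^ 2) := by gcongr
      _ ≤ e₂⁻¹ / 2 * (1 / r * (K₁ * √r * (2 * √ρ) * e₂) ^ 2) := by gcongr
      _ = 2 * K₁ ^ 2 * (√r ^ 2 / r) * √ρ ^ 2 * e₂ := by
        field_simp
      _ = 2 * K₁ ^ 2 * ρ * e₂ := by rw [hsq, hr2, div_self hr.ne', mul_one]
  linarith

lemma sum_exp_le {γ : ℝ} (hγ : 0 < γ) (n : ℕ) :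
    ∑ k ∈ Finset.Icc 1 n, Real.exp (-γ * ((k : ℝ) - 1)) ≤ (1 - Real.exp (-γ))⁻¹ := by
  have hlt : Real.exp (-γ) < 1 := Real.exp_lt_one_iff.2 (by linarith)
  have e : ∑ k ∈ Finset.Icc 1 n, Real.exp (-γ * ((k : ℝ) - 1)) =
      ∑ k ∈ Finset.range n, Real.exp (-γ) ^ k := by
    induction n with
    | zero => simp
    | succ n ih =>
      rw [Finset.sum_Icc_succ_top (by omega), ih, Finset.sum_range_succ, ← Real.exp_nat_mul]
      push_cast
      ring_nf
  rw [e, ← tsum_geometric_of_lt_one (Real.exp_pos _).le hlt]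
  exact (summable_geometric_of_lt_one (Real.exp_pos _).le hlt).sum_le_tsum _
    fun k _ => by positivity

/-- The constant in the smoothing bound for the variance proxy. -/
noncomputable def proxyConst (γ₂ γ₄ K₁ K₃ : ℝ) : ℝ :=
  2 + 2 * ((1 + 2 * K₃ ^ 2) * (1 - Real.exp (-γ₄))⁻¹ +
    (1 + 2 * K₁ ^ 2) * (1 - Real.exp (-γ₂))⁻¹)

lemma integral_varianceProxy_le (hst : IsStationaryProcess P Y)
    (hL2 : ∀ t, MemLp (Y t) 2 P) (hmean : ∀ t, ∫ ω, Y t ω ∂P = 0) {r ρ K₁ K₃ : ℝ} (hr : 0 < r)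
    (hρ : 0 < ρ) (hnorm : ‖autocov P Y 0‖ = ρ) (htr : (autocov P Y 0).trace = r * ρ)
    (hκ : kappaOne P Y ≤ ENNReal.ofReal (2 * √ρ)) (hε : 1 < ε) (hγ₁ : 0 ≤ γ₁) (hγ₃ : 0 ≤ γ₃)
    (hγ₂ : 0 < γ₂) (hγ₄ : 0 < γ₄)
    (h1 : NormCoupling P Y γ₁ γ₂ ε) (h3 : DirectionalCoupling P Y γ₃ γ₄ ε)
    (hK₁ : γ₁ ≤ K₁ * √r) (hK₃ : γ₃ ≤ K₃) (n : ℕ) (b : EuclideanSpace ℝ (Fin p))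
    (hb : ‖b‖ ≤ 1) {σ : ℝ} (hσ : σ ^ 2 = 1 / r) :
    ∫ z, varianceProxy P Y n (b + σ • z) ∂stdGaussian (EuclideanSpace ℝ (Fin p)) ≤
      proxyConst γ₂ γ₄ K₁ K₃ * ρ := by
  have i0 := fun k => integrable_abs_quadraticForm (autocov P Y k) b σ
  have i1 := integrable_finsetSum (Finset.Icc 1 n) fun k _ => i0 k
  unfold varianceProxy
  rw [integral_add (i0 0) (i1.const_mul 2), integral_const_mul,
    integral_finsetSum _ fun k _ => i0 k]
  -- At lag 0 no coupling is needed: `ρ` comes from the direction `b` and another `ρ` from `σ² Tr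
  -- Σ₀`.
  have hzero : ∫ z, |inner ℝ (b + σ • z)
      (Matrix.toEuclideanCLM (𝕜 := ℝ) (autocov P Y 0) (b + σ • z))|
      ∂stdGaussian (EuclideanSpace ℝ (Fin p)) ≤ 2 * ρ := by
    have e : ∀ z, |inner ℝ (b + σ • z)
        (Matrix.toEuclideanCLM (𝕜 := ℝ) (autocov P Y 0) (b + σ • z))| =
        ∫ ω, inner ℝ (b + σ • z) (Y 1 ω) ^ 2 ∂P := fun z => by
      rw [← integral_inner_sq hst hL2 1]
      exact abs_of_nonneg (integral_nonneg fun ω => sq_nonneg _)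
    simp_rw [e]
    rw [(integral_stdGaussian_secondMoment (hL2 1) b σ).2, integral_norm_sq hst hL2, htr, hσ]
    have hV := integral_inner_sq_le hst hL2 1 b
    rw [hnorm] at hV
    have : ρ * ‖b‖ ^ 2 ≤ ρ := mul_le_of_le_one_right hρ.le (pow_le_one₀ (norm_nonneg _) hb)
    have : 1 / r * (r * ρ) = ρ := by field_simp
    linarith
  have hsum := Finset.sum_le_sum fun k (hk : k ∈ Finset.Icc 1 n) =>
    integral_abs_quadraticForm_autocov_le hst hL2 hmean hr hρ hnorm htr hκ hε hγ₁ hγ₃ h1 h3 hK₁ hK₃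
      (Finset.mem_Icc.1 hk).1 b hb hσ
  rw [← Finset.mul_sum, Finset.sum_add_distrib, ← Finset.mul_sum, ← Finset.mul_sum] at hsum
  have s2 := sum_exp_le hγ₂ n
  have s4 := sum_exp_le hγ₄ n
  have hfin : ρ * ((1 + 2 * K₃ ^ 2) * ∑ k ∈ Finset.Icc 1 n, Real.exp (-γ₄ * ((k : ℝ) - 1)) +
      (1 + 2 * K₁ ^ 2) * ∑ k ∈ Finset.Icc 1 n, Real.exp (-γ₂ * ((k : ℝ) - 1))) ≤
      ρ * ((1 + 2 * K₃ ^ 2) * (1 - Real.exp (-γ₄))⁻¹ +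
        (1 + 2 * K₁ ^ 2) * (1 - Real.exp (-γ₂))⁻¹) := by gcongr
  unfold proxyConst
  linarith

end VarianceProxy

/-! ### Reduction to a finite-dimensional Gaussian block. -/

section Block

variable {p : ℕ} {Ω : Type u} [MeasurableSpace Ω] {P : Measure Ω}
  {Y : ℤ → Ω → EuclideanSpace ℝ (Fin p)}

/-- The value at time `t` of a block of vectors indexed by `I`, and `0` if `t ∉ I`. -/
noncomputable def blockEval (p : ℕ) (I : Finset ℤ) (t : ℤ) :
    (I → EuclideanSpace ℝ (Fin p)) →L[ℝ] EuclideanSpace ℝ (Fin p) :=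
  if h : t ∈ I then ContinuousLinearMap.proj ⟨t, h⟩ else 0

lemma blockEval_restrict {Ω : Type u} {Y : ℤ → Ω → EuclideanSpace ℝ (Fin p)} {I : Finset ℤ}
    {t : ℤ} (h : t ∈ I) (ω : Ω) :
    blockEval p I t (I.restrict (Y · ω)) = Y t ω := by
  simp [blockEval, h]

lemma integral_id_map_restrict (hG : IsGaussianProcess Y P) (hmean : ∀ t, ∫ ω, Y t ω ∂P = 0)
    (I : Finset ℤ) : ∫ v, id v ∂P.map (fun ω => I.restrict (Y · ω)) = 0 := by
  have hX := hG.hasGaussianLaw I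
  rw [integral_map hX.aemeasurable aestronglyMeasurable_id]
  ext1 i
  change (∫ ω, (fun i : I => Y i ω) ∂P) i = 0
  rw [eval_integral fun i : I => (hG.hasGaussianLaw_eval i).integrable]
  exact hmean i

lemma outerSum_blockEval {Ω : Type u} {Y : ℤ → Ω → EuclideanSpace ℝ (Fin p)} {I : Finset ℤ}
    {s : Finset ℕ} {m : ℕ} (h1 : ∀ i ∈ s, (i : ℤ) ∈ I) (h2 : ∀ i ∈ s, (i : ℤ) + m ∈ I) (ω : Ω) :
    outerSum s (fun i => blockEval p I i (I.restrict (Y · ω)))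
        (fun i => blockEval p I (i + m) (I.restrict (Y · ω))) =
      outerSum s (fun i => Y i ω) (fun i => Y (i + m) ω) := by
  refine Finset.sum_congr rfl fun i hi => ?_
  simp only
  rw [blockEval_restrict (h1 i hi), blockEval_restrict (h2 i hi)]

lemma integral_map_restrict_sq_sum (hG : IsGaussianProcess Y P) {I : Finset ℤ} {s : Finset ℕ}
    {d : ℤ} (h : ∀ i ∈ s, (i : ℤ) + d ∈ I) (c : ℕ → ℝ) (b : EuclideanSpace ℝ (Fin p)) :
    ∫ v, (∑ i ∈ s, c i * inner ℝ b (blockEval p I (i + d) v)) ^ 2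
        ∂P.map (fun ω => I.restrict (Y · ω)) =
      ∫ ω, (∑ i ∈ s, c i * inner ℝ b (Y (i + d) ω)) ^ 2 ∂P := by
  rw [integral_map (hG.hasGaussianLaw I).aemeasurable
    (Continuous.aestronglyMeasurable (by fun_prop))]
  refine integral_congr_ae (Filter.Eventually.of_forall fun ω => ?_)
  simp only
  congr 1
  exact Finset.sum_congr rfl fun i hi => by rw [blockEval_restrict (h i hi)]

lemma integral_map_restrict_outerSum (hG : IsGaussianProcess Y P)
    (hst : IsStationaryProcess P Y) {I : Finset ℤ} {s : Finset ℕ} {m : ℕ}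
    (h1 : ∀ i ∈ s, (i : ℤ) ∈ I) (h2 : ∀ i ∈ s, (i : ℤ) + m ∈ I) (a b : Fin p) :
    ∫ v, outerSum s (fun i => blockEval p I i v) (fun i => blockEval p I (i + m) v) a b
        ∂P.map (fun ω => I.restrict (Y · ω)) = ((s.card : ℝ) • autocov P Y m) a b := by
  have hL2 : ∀ t, MemLp (Y t) 2 P := fun t => (hG.hasGaussianLaw_eval t).memLp_two
  have hc : Continuous fun v => outerSum s (fun i => blockEval p I i v)
      (fun i => blockEval p I (i + m) v) :=
    continuous_outerSum s (fun i => by fun_prop) (fun i => by fun_prop)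
  rw [integral_map (hG.hasGaussianLaw I).aemeasurable
    (hc.matrix_elem a b).aestronglyMeasurable]
  simp_rw [outerSum_blockEval h1 h2]
  simp only [outerSum, Matrix.sum_apply, Matrix.of_apply]
  have hint : ∀ i ∈ s, Integrable (fun ω => Y i ω a * Y (i + m) ω b) P := fun i _ =>
    ((hL2 i).coord a).integrable_mul ((hL2 (i + m)).coord b)
  rw [integral_finsetSum _ hint]
  simp_rw [integral_coord_mul_coord hst]
  simp

end Block

/-! ### The main theorem. -/

theorem theorem2p2 (ε γ₂ γ₄ K₁ K₃ : ℝ) (m : ℕ) (hε : 1 < ε) (hγ₂ : 0 < γ₂) (hγ₄ : 0 < γ₄)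
    (hK₁ : 0 < K₁) (hK₃ : 0 < K₃) :
    ∃ C : ℝ, 0 < C ∧
      ∀ (p : ℕ) (Ω : Type u) [MeasurableSpace Ω] (P : Measure Ω) [IsProbabilityMeasure P]
        (Y : ℤ → Ω → EuclideanSpace ℝ (Fin p)) (γ₁ γ₃ : ℝ),
        IsGaussianProcess Y P →
        (∀ t, ∫ ω, Y t ω ∂P = 0) →
        IsStationaryProcess P Y →
        0 < γ₁ → 0 < γ₃ →
        NormCoupling P Y γ₁ γ₂ ε →
        DirectionalCoupling P Y γ₃ γ₄ ε →
        γ₁ ≤ K₁ * Real.sqrt (effRank (autocov P Y 0)) →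
        γ₃ ≤ K₃ →
        ∀ n : ℕ, 2 ≤ n → m ≤ n - 1 →
          Integrable (fun ω => ‖sampleAutocov Y n m ω - autocov P Y m‖) P ∧
          ∫ ω, ‖sampleAutocov Y n m ω - autocov P Y m‖ ∂P ≤
            C * ‖autocov P Y 0‖ *
              (Real.sqrt (effRank (autocov P Y 0) / ((n : ℝ) - (m : ℝ))) +
                effRank (autocov P Y 0) / ((n : ℝ) - (m : ℝ))) := by
  set c := proxyConst γ₂ γ₄ K₁ K₃ with hc
  have hc0 : 0 < c := by
    have h2 : Real.exp (-γ₂) < 1 := Real.exp_lt_one_iff.2 (by linarith)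
    have h4 : Real.exp (-γ₄) < 1 := Real.exp_lt_one_iff.2 (by linarith)
    have h2' : 0 < (1 - Real.exp (-γ₂))⁻¹ := inv_pos.2 (by linarith)
    have h4' : 0 < (1 - Real.exp (-γ₄))⁻¹ := inv_pos.2 (by linarith)
    rw [hc, proxyConst]
    positivity
  refine ⟨4 * (c + 1) + 8 * c, by positivity, ?_⟩
  intro p Ω _ P _ Y γ₁ γ₃ hG hmean hst hγ₁ hγ₃ h1 h3 hle₁ hle₃ n hn hmn
  have hL2 : ∀ t, MemLp (Y t) 2 P := fun t => (hG.hasGaussianLaw_eval t).memLp_two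
  set r := effRank (autocov P Y 0) with hr
  set ρ := ‖autocov P Y 0‖ with hρ
  -- Nondegeneracy of `Σ₀` is forced by `0 < γ₁ ≤ K₁ √r`: if `Σ₀` were zero, then `r = 0` by the
  -- convention on division by zero.
  have hr0 : 0 < r := Real.sqrt_pos.1 (pos_of_mul_pos_right (hγ₁.trans_le hle₁) hK₁.le)
  have hρ0 : 0 < ρ := by
    refine lt_of_le_of_ne (norm_nonneg _) fun h => hr0.ne' ?_
    rw [hr, effRank, ← hρ, ← h, div_zero]
  have htr : (autocov P Y 0).trace = r * ρ := by
    rw [hr, effRank, ← hρ, div_mul_cancel₀ _ hρ0.ne']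
  have hκ := kappaOne_le hG hmean hst hρ0
  rw [← hρ] at hκ
  set N := n - m with hN
  have hN1 : 1 ≤ N := by omega
  have hNcast : (n : ℝ) - (m : ℝ) = N := by rw [hN, Nat.cast_sub (by omega)]
  have hN0 : (0 : ℝ) < N := by exact_mod_cast hN1
  set s := Finset.Icc 1 N with hs
  have hcard : (s.card : ℝ) = N := by simp [hs]
  -- All times `i` and `i + m` with `1 ≤ i ≤ n - m` lie in this block, so the zero default of
  -- `blockEval` is never reached.
  set I := Finset.Icc (1 : ℤ) n with hI
  have hm1 : ∀ i ∈ s, (i : ℤ) ∈ I := fun i hi => by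
    simp only [hs, hI, Finset.mem_Icc] at hi ⊢; omega
  have hm2 : ∀ i ∈ s, (i : ℤ) + m ∈ I := fun i hi => by
    simp only [hs, hI, Finset.mem_Icc] at hi ⊢; omega
  have hm0 : ∀ i ∈ s, (i : ℤ) + (0 : ℕ) ∈ I := fun i hi => by simpa using hm1 i hi
  have hX := hG.hasGaussianLaw I
  have hμ := integral_id_map_restrict hG hmean I
  set μ := P.map (fun ω => I.restrict (Y · ω)) with hμdef
  have : IsGaussian μ := hX.isGaussian_map
  have hvar : ∀ (d : ℕ), (∀ i ∈ s, (i : ℤ) + d ∈ I) → ∀ (a : ℕ → ℝ) b,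
      ∫ v, (∑ i ∈ s, a i * inner ℝ b (blockEval p I (i + d) v)) ^ 2 ∂μ ≤
        (∑ i ∈ s, a i ^ 2) * varianceProxy P Y N b := fun d hd a b => by
    rw [hμdef, integral_map_restrict_sq_sum hG hd]
    exact integral_sq_sum_le_varianceProxy hst hL2 N d a b
  -- By stationarity a single proxy serves both the unshifted vectors `U` and the vectors `V`
  -- shifted by `m`.
  have hmain := integral_norm_outerSum_sub_le_of_variance_proxy hμ s
    (Finset.nonempty_Icc.2 hN1) (measurable_varianceProxy (P := P) (Y := Y) N) hc0 hr0 hρ0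
    (fun i : ℕ => blockEval p I i) (fun i : ℕ => blockEval p I (i + m))
    (by simpa using hvar 0 hm0) (hvar m hm2)
    (fun b σ => integrable_varianceProxy N b σ)
    (fun b σ hb _ hσ => integral_varianceProxy_le hst hL2 hmean hr0 hρ0 rfl htr hκ hε hγ₁.le
      hγ₃.le hγ₂ hγ₄ h1 h3 hle₁ hle₃ N b hb hσ)
    (fun i hi => by
      rw [hμdef, integral_map hX.aemeasurable (Continuous.aestronglyMeasurable (by fun_prop))]
      simp_rw [blockEval_restrict (hm1 i hi)]
      rw [integral_norm_sq hst hL2, htr])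
    (M₀ := (s.card : ℝ) • autocov P Y 0) (M := (s.card : ℝ) • autocov P Y m)
    (by rw [norm_smul]; simp [hρ])
    (fun j k => by
      have := integral_map_restrict_outerSum hG hst hm1 hm0 j k
      simpa using this)
    (fun j k => integral_map_restrict_outerSum hG hst hm1 hm2 j k)
  have hint : Integrable (fun v => ‖outerSum s (fun i : ℕ => blockEval p I i v)
      (fun i : ℕ => blockEval p I (i + m) v) - (s.card : ℝ) • autocov P Y m‖) μ :=
    ((integrable_outerSum s _ _).sub (integrable_const _)).norm
  have hmeas := hint.1
  rw [hμdef, integral_map hX.aemeasurable hmeas] at hmain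
  have hint' := hint.comp_aemeasurable hX.aemeasurable
  simp only [Function.comp_def] at hint'
  simp_rw [outerSum_blockEval hm1 hm2] at hmain hint'
  have hsample : ∀ ω, ‖sampleAutocov Y n m ω - autocov P Y m‖ =
      (N : ℝ)⁻¹ * ‖outerSum s (fun i : ℕ => Y i ω) (fun i : ℕ => Y (i + m) ω) -
        (s.card : ℝ) • autocov P Y m‖ := fun ω => by
    have e : sampleAutocov Y n m ω - autocov P Y m = (N : ℝ)⁻¹ •
        (outerSum s (fun i : ℕ => Y i ω) (fun i : ℕ => Y (i + m) ω) -
          (s.card : ℝ) • autocov P Y m) := by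
      rw [smul_sub, hcard, smul_smul, inv_mul_cancel₀ hN0.ne', one_smul, sampleAutocov, hNcast]
      rfl
    rw [e, norm_smul, norm_inv, Real.norm_of_nonneg hN0.le]
  simp_rw [hsample]
  refine ⟨hint'.const_mul _, ?_⟩
  rw [integral_const_mul, hNcast]
  have hsqrt : √(r / N) = √(r * N) / N := by
    rw [show r / N = r * N / (N : ℝ) ^ 2 by field_simp, Real.sqrt_div (by positivity),
      Real.sqrt_sq hN0.le]
  rw [hcard] at hmain
  -- Dividing by `N` turns `√(r N)` into `√(r / N)`; the two coefficients `4(c + 1)` and `8c` are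
  -- then both replaced by their sum.
  calc _ ≤ (N : ℝ)⁻¹ * (4 * ρ * ((c + 1) * √(r * N) + 2 * c * r)) := by
        refine mul_le_mul_of_nonneg_left ?_ (by positivity)
        rwa [hcard]
    _ = ρ * (4 * (c + 1) * √(r / N) + 8 * c * (r / N)) := by
        rw [hsqrt]
        field_simp
        ring
    _ ≤ ρ * ((4 * (c + 1) + 8 * c) * √(r / N) + (4 * (c + 1) + 8 * c) * (r / N)) := by
        gcongr
        · linarith
        · linarith
    _ = _ := by ring
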